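/- Let $\mathcal X,\mathcal Y$ be real Hilbert spaces, with $\|(x,\lambda)\|=\sqrt{\|x\|^2+\|\lambda\|^2}$ on $\mathcal X\times\mathcal Y$. Let $f:\mathcal X\to\mathbb R$ be convex and continuously differentiable, $A:\mathcal X\to\mathcal Y$ a continuous linear operator and $b\in\mathcal Y$. Put $$\mathcal L(x,\lambda)=f(x)+\langle\lambda,Ax-b\rangle,\qquad \mathcal L_t(x,\lambda)=\mathcal L(x,\lambda)+\frac{c}{2t^p}\left(\|x\|^2-\|\lambda\|^2\right).$$ A saddle point of $F:\mathcal X\times\mathcal Y\to\mathbb R$ is a pair $(\hat x,\hat\lambda)$ with $F(\hat x,\lambda)\le F(\hat x,\hat\lambda)\le F(x,\hat\lambda)$ for all $(x,\lambda)$. Let $\Omega$ be the set of saddle points of $\mathcal L$, and suppose that $\Omega\neq\emptyset$. Let $$\alpha>0,\quad \theta>\tfrac1\alpha,\quad 0\le q<1,\quad 0<p<1-q,\quad c>0,\quad t_0>0,\quad p-q-1<s<1-3q.$$ Then $\Omega$ has a unique element $(x^*,\lambda^*)$ of minimum norm, and for every $t\ge t_0$ the function $\mathcal L_t$ has a unique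 saddle point $(x_t,\lambda_t)$. Let $(x,\lambda):[t_0,+\infty)\to\mathcal X\times\mathcal Y$ be any solution ($x$ twice differentiable and $\lambda$ differentiable, with one-sided derivatives at $t_0$) of $$\begin{cases}\ddot x(t)+\dfrac{\alpha}{t^q}\dot x(t)+t^s\left(\nabla_x\mathcal L(x(t),\lambda(t))+\dfrac{c}{t^p}x(t)\right)=0,\\[2mm]\dot\lambda(t)-t^{q+s}\left(\nabla_\lambda\mathcal L(x(t)+\theta t^q\dot x(t),\lambda(t))-\dfrac{c}{t^p}\lambda(t)\right)=0,\end{cases}\qquad t\ge t_0.$$ Then $\lim_{t\to+\infty}\|(x(t),\lambda(t))-(x^*,\lambda^*)\|=0$, and the following estimates hold as $t\to+\infty$. (i) If $p-q-1<s<\frac{p-3q-1}{2}$, then $$\|x(t)-x_t\|^2=\mathcal O\left(\frac1{t^{2(1+s+q-p)}}\right),\qquad \|\lambda(t)-\lambda_t\|^2=\mathcal O\left(\frac1{t^{2(1+s+q-p)}}\right),$$ $$\|\dot x(t)\|^2=\mathcal O\left(\frac1{t^{2(1+s+2q-p)}}\right),\qquad \|Ax(t)-b\|=\mathcal O\left(\frac1{t^p}+\frac1{t^{1+s+q-p}}\right).$$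 If moreover $\frac{2p-2-4q}{3}<s<\frac{p-3q-1}{2}$, then $$\mathcal L_t(x(t),\lambda_t)-\mathcal L_t(x_t,\lambda_t)=\mathcal O\left(\frac1{t^{4q+3s-2p+2}}\right),$$ $$\mathcal L(x(t),\lambda^*)-\mathcal L(x^*,\lambda^*)=\mathcal O\left(\frac1{t^p}+\frac1{t^{4q+3s-2p+2}}\right),\qquad |f(x(t))-f(x^*)|=\mathcal O\left(\frac1{t^p}+\frac1{t^{4q+3s-2p+2}}\right).$$ (ii) If $\frac{p-3q-1}{2}\le s<1-3q$, then, with $r=\max\{q,p-q-s\}$, $$\mathcal L_t(x(t),\lambda_t)-\mathcal L_t(x_t,\lambda_t)=\mathcal O\left(\frac1{t^{1-r}}\right),\qquad \|x(t)-x_t\|^2=\mathcal O\left(\frac1{t^{1-2q-s-r}}\right),$$ $$\|\lambda(t)-\lambda_t\|^2=\mathcal O\left(\frac1{t^{1-2q-s-r}}\right),\qquad \|\dot x(t)\|^2=\mathcal O\left(\frac1{t^{1-s-r}}\right),$$ and each of $\mathcal L(x(t),\lambda^*)-\mathcal L(x^*,\lambda^*)$, $|f(x(t))-f(x^*)|$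 and $\|Ax(t)-b\|$ is $$\mathcal O\left(\frac1{t^p}+\frac1{t^{(1-2q-s-r)/2}}\right).$$ -/

import Mathlib

open Set Filter Topology Asymptotics

noncomputable section

namespace TikhonovPD

variable {X Y : Type*}
  [NormedAddCommGroup X] [InnerProductSpace ℝ X] [CompleteSpace X]
  [NormedAddCommGroup Y] [InnerProductSpace ℝ Y] [CompleteSpace Y]

/-- The Lagrangian `f(x) + ⟨l, A x - b⟩` of the problem `min f(x)` subject to `A x = b`. -/
def lagrangian (f : X → ℝ) (A : X →L[ℝ] Y) (b : Y) (x : X) (l : Y) : ℝ :=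
  f x + inner ℝ l (A x - b)

/-- The Tikhonov-regularized Lagrangian
`L(x, l) + c / (2 t ^ p) * (‖x‖ ^ 2 - ‖l‖ ^ 2)` at time `t`. -/
def regLagrangian (f : X → ℝ) (A : X →L[ℝ] Y) (b : Y) (c p t : ℝ) (x : X) (l : Y) : ℝ :=
  lagrangian f A b x l + c / (2 * t ^ p) * (‖x‖ ^ 2 - ‖l‖ ^ 2)

/-- The set of saddle points of `F` on the whole product, where `F` is minimized in the first and
maximized in the second variable: pairs `z` with `F z.1 m ≤ F x z.2` for all `x` and `m`, that is,
`F z.1 m ≤ F z.1 z.2 ≤ F x z.2` for all `x` and `m`. -/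
def saddleSet (F : X → Y → ℝ) : Set (X × Y) :=
  {z | IsSaddlePointOn univ univ F z.1 z.2}

/-- The norm `√(‖x‖ ^ 2 + ‖l‖ ^ 2)` on the product of the two Hilbert spaces (Mathlib's norm
on `X × Y` itself is the maximum norm). -/
def pairNorm (z : X × Y) : ℝ := ‖WithLp.toLp 2 z‖

/-- `z` is an element of minimum norm of `S`. -/
def IsMinNormElement (S : Set (X × Y)) (z : X × Y) : Prop :=
  z ∈ S ∧ ∀ w ∈ S, pairNorm z ≤ pairNorm w

/-- The derivative of a curve on `[t₀, ∞)`, one-sided at the initial time `t₀`. -/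
def velocity {E : Type*} [NormedAddCommGroup E] [NormedSpace ℝ E]
    (t₀ : ℝ) (x : ℝ → E) : ℝ → E :=
  derivWithin x (Ici t₀)

/-- `(x, l)` is a (classical) solution on `[t₀, ∞)` of the Tikhonov-regularized inertial
primal-dual system; only the values of `x` and `l` on `[t₀, ∞)` matter. -/
structure IsTrajectory (f : X → ℝ) (A : X →L[ℝ] Y) (b : Y) (α θ q p s c t₀ : ℝ)
    (x : ℝ → X) (l : ℝ → Y) : Prop where
  differentiableOn_primal : DifferentiableOn ℝ x (Ici t₀)
  differentiableOn_velocity : DifferentiableOn ℝ (velocity t₀ x) (Ici t₀)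
  differentiableOn_dual : DifferentiableOn ℝ l (Ici t₀)
  primal_eq : ∀ t, t₀ ≤ t →
    velocity t₀ (velocity t₀ x) t + (α / t ^ q) • velocity t₀ x t
      + t ^ s • (gradient (fun u => lagrangian f A b u (l t)) (x t) + (c / t ^ p) • x t) = 0
  dual_eq : ∀ t, t₀ ≤ t →
    velocity t₀ l t
      - t ^ (q + s) •
        (gradient (fun m => lagrangian f A b (x t + (θ * t ^ q) • velocity t₀ x t) m) (l t)
          - (c / t ^ p) • l t) = 0

end TikhonovPD

end

set_option linter.unusedSectionVars false

noncomputable section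

namespace TikhonovPD

variable {X Y : Type*}
  [NormedAddCommGroup X] [InnerProductSpace ℝ X] [CompleteSpace X]
  [NormedAddCommGroup Y] [InnerProductSpace ℝ Y] [CompleteSpace Y]

open scoped InnerProductSpace Gradient

/-! Saddle points of the Lagrangian regularized with parameter `e` are the zeros of `T + e • id`,
where `T` is the monotone saddle operator (`mem_saddleSet_iff_isKKT`, `saddleOperator_eq_iff`).
Monotonicity alone gives the classical Tikhonov picture: the regularized zeros z_t converge strongly
to the zero of minimum norm (`exists_tendsto_regularized_zeros`), and ‖z_τ - z_t‖ ≤ (τ^p/t^p - 1) M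
for τ ≥ t, so the path moves with speed at most p M / t. It remains to show that the trajectory
catches up with z_t.

For this the Lyapunov function `energy` combines the gap of the regularized Lagrangian, weighted by
θ² t^(2q+s), with squared distances to z_t. If z_t were fixed, all cross terms would cancel
(`inner_dissipation`). What is left dissipates the gap at order t^(q+s), both squared distances at
order t^(q+s-p) and the squared velocity at order t^q. Compared with the weights in the energy, this
is a decay rate t^(-r) as soon as r ≥ q and r ≥ p-q-s.

The motion of z_t is only controlled in norm, so the energy is not differentiated. At each time t
the saddle point is frozen, and for τ ≥ t the energy is bounded by a differentiable majorant that
touches it at t (`exists_majorant`); the drift enters only through ρ(τ) = (τ^p/t^p - 1) M, with ρ(t)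
= 0 and ρ'(t) = p M / t. After Young's inequality with parameter δ t^(1-r), the drift costs a small
part of the dissipation plus sources of order t^(2q+s-1) and t^(r-2) (`exists_absorption`). The
barrier lemma `exists_le_mul_rpow_of_dissipative_majorant` then yields energy = O(t^(m+r)) for m at
least both source exponents. The two regimes of the theorem correspond to which source dominates. -/

/-! ### Convexity inequalities and the optimality system of a saddle point -/

theorem inner_gradient_le_sub {f : X → ℝ} (hconv : ConvexOn ℝ univ f) {g x : X}
    (hg : HasGradientAt f g x) (y : X) : f x + ⟪g, y - x⟫_ℝ ≤ f y := by
  have hl : HasDerivAt (fun s : ℝ => x + s • (y - x)) (y - x) 0 := by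
    simpa using ((hasDerivAt_id (0 : ℝ)).smul_const (y - x)).const_add x
  have hd : HasDerivAt (fun s : ℝ => f (x + s • (y - x))) ⟪g, y - x⟫_ℝ 0 := by
    have h0 : HasFDerivAt f (InnerProductSpace.toDual ℝ X g) (x + (0 : ℝ) • (y - x)) := by
      simpa using hg.hasFDerivAt
    simpa [Function.comp_def] using h0.comp_hasDerivAt (0 : ℝ) hl
  have hc : ConvexOn ℝ univ (fun s : ℝ => f (x + s • (y - x))) := by
    refine ⟨convex_univ, fun a _ b _ u v hu hv huv => ?_⟩
    have h := hconv.2 (mem_univ (x + a • (y - x))) (mem_univ (x + b • (y - x))) hu hv huv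
    have he : x + (u • a + v • b) • (y - x)
        = u • (x + a • (y - x)) + v • (x + b • (y - x)) := by
      obtain rfl : v = 1 - u := by linarith
      simp only [smul_eq_mul]
      module
    simp only
    rw [he]
    exact h
  have := hc.le_slope_of_hasDerivAt (mem_univ 0) (mem_univ 1) one_pos hd
  simp [slope_def_field] at this
  linarith

theorem norm_sq_add_inner_le (x y : X) : ‖x‖ ^ 2 + 2 * ⟪x, y - x⟫_ℝ + ‖y - x‖ ^ 2 = ‖y‖ ^ 2 := by
  have := norm_add_sq_real x (y - x)
  rw [add_sub_cancel] at this
  linarith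

theorem norm_sq_half_smul_add (v w : X) :
    ‖(1 / 2 : ℝ) • (v + w)‖ ^ 2 = (‖v‖ ^ 2 + ‖w‖ ^ 2) / 2 - ‖v - w‖ ^ 2 / 4 := by
  have := norm_add_sq_real v w
  have := norm_sub_sq_real v w
  rw [norm_smul, mul_pow, Real.norm_eq_abs, sq_abs]
  linarith

/-- The optimality system of the Lagrangian regularized with parameter `e`. -/
def IsKKT (G : X → X) (A : X →L[ℝ] Y) (b : Y) (e : ℝ) (z : X × Y) : Prop :=
  G z.1 + A.adjoint z.2 + e • z.1 = 0 ∧ A z.1 - b = e • z.2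

theorem hasGradientAt_primal {f : X → ℝ} {g x : X} (hg : HasGradientAt f g x)
    (A : X →L[ℝ] Y) (b : Y) (e : ℝ) (l : Y) :
    HasGradientAt (fun u => f u + ⟪l, A u - b⟫_ℝ + e / 2 * (‖u‖ ^ 2 - ‖l‖ ^ 2))
      (g + A.adjoint l + e • x) x := by
  have h1 := hg.hasFDerivAt
  have h2 : HasFDerivAt (fun u => ⟪l, A u - b⟫_ℝ) ((innerSL ℝ l).comp A) x := by
    exact (innerSL ℝ l).hasFDerivAt.comp x (A.hasFDerivAt.sub_const b)
  have h3 : HasFDerivAt (fun u : X => e / 2 * (‖u‖ ^ 2 - ‖l‖ ^ 2)) (e • innerSL ℝ x) x := by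
    have := (((hasFDerivAt_id x).norm_sq).sub_const (‖l‖ ^ 2)).const_mul (e / 2)
    refine this.congr_fderiv ?_
    ext v
    simp
    ring
  rw [hasGradientAt_iff_hasFDerivAt]
  refine ((h1.add h2).add h3).congr_fderiv ?_
  ext v
  simp [ContinuousLinearMap.adjoint_inner_left]

theorem hasGradientAt_dual (B : ℝ) (v : Y) (e k : ℝ) (l : Y) :
    HasGradientAt (fun m => B + ⟪m, v⟫_ℝ + e / 2 * (k - ‖m‖ ^ 2)) (v - e • l) l := by
  have h2 : HasFDerivAt (fun m => ⟪m, v⟫_ℝ) (innerSL ℝ v) l := by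
    simpa [real_inner_comm] using (innerSL ℝ v).hasFDerivAt (x := l)
  have h3 : HasFDerivAt (fun m : Y => e / 2 * (k - ‖m‖ ^ 2)) (-(e • innerSL ℝ l)) l := by
    have := (((hasFDerivAt_id l).norm_sq).const_sub k).const_mul (e / 2)
    refine this.congr_fderiv ?_
    ext v
    simp
    ring
  rw [hasGradientAt_iff_hasFDerivAt]
  refine ((h2.const_add B).add h3).congr_fderiv ?_
  ext v
  simp [sub_eq_add_neg]

theorem strong_convexity_gap {f : X → ℝ} (hconv : ConvexOn ℝ univ f) {g x : X}
    (hg : HasGradientAt f g x) (A : X →L[ℝ] Y) (b : Y) (e : ℝ) (l : Y) (y : X) :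
    f x + ⟪l, A x - b⟫_ℝ + e / 2 * (‖x‖ ^ 2 - ‖l‖ ^ 2) + ⟪g + A.adjoint l + e • x, y - x⟫_ℝ
        + e / 2 * ‖y - x‖ ^ 2
      ≤ f y + ⟪l, A y - b⟫_ℝ + e / 2 * (‖y‖ ^ 2 - ‖l‖ ^ 2) := by
  have h1 := inner_gradient_le_sub hconv hg y
  have h2 : ⟪A.adjoint l, y - x⟫_ℝ = ⟪l, A y - b⟫_ℝ - ⟪l, A x - b⟫_ℝ := by
    rw [ContinuousLinearMap.adjoint_inner_left, ← inner_sub_right, map_sub]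
    congr 1; abel
  have h3 := norm_sq_add_inner_le x y
  rw [inner_add_left, inner_add_left, h2, real_inner_smul_left, ← h3]
  nlinarith

theorem strong_concavity_gap (v : Y) (e : ℝ) (l m : Y) :
    ⟪m, v⟫_ℝ - e / 2 * ‖m‖ ^ 2
      = ⟪l, v⟫_ℝ - e / 2 * ‖l‖ ^ 2 + ⟪v - e • l, m - l⟫_ℝ - e / 2 * ‖m - l‖ ^ 2 := by
  rw [← norm_sq_add_inner_le l m, inner_sub_left, real_inner_smul_left, inner_sub_right v,
    real_inner_comm m v, real_inner_comm l v]
  ring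

/-- The optimality system is the first-order condition in each variable. Conversely, when the
gradients vanish, the linear terms of the strong convexity and concavity expansions vanish and the
remaining quadratic terms have the right sign. The value `e = 0` is allowed, so the original
Lagrangian is covered as well. -/
theorem mem_saddleSet_iff_isKKT {f : X → ℝ} (hconv : ConvexOn ℝ univ f) {G : X → X}
    (hG : ∀ x, HasGradientAt f (G x) x) (A : X →L[ℝ] Y) (b : Y) {e : ℝ} (he : 0 ≤ e)
    (z : X × Y) :
    z ∈ saddleSet (fun x l => f x + ⟪l, A x - b⟫_ℝ + e / 2 * (‖x‖ ^ 2 - ‖l‖ ^ 2))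
      ↔ IsKKT G A b e z := by
  obtain ⟨x, l⟩ := z
  simp only [saddleSet, mem_ofPred_eq, IsSaddlePointOn, mem_univ, true_imp_iff, IsKKT]
  constructor
  · intro h
    constructor
    · have hmin : IsLocalMin
          (fun u => f u + ⟪l, A u - b⟫_ℝ + e / 2 * (‖u‖ ^ 2 - ‖l‖ ^ 2)) x :=
        Eventually.of_forall fun u => h u l
      have := hmin.hasFDerivAt_eq_zero (hasGradientAt_primal (hG x) A b e l).hasFDerivAt
      simpa only [map_eq_zero_iff _ (LinearIsometryEquiv.injective _)] using this
    · have hmax : IsLocalMax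
          (fun m => f x + ⟪m, A x - b⟫_ℝ + e / 2 * (‖x‖ ^ 2 - ‖m‖ ^ 2)) l :=
        Eventually.of_forall fun m => h x m
      have := hmax.hasFDerivAt_eq_zero (hasGradientAt_dual (f x) (A x - b) e _ l).hasFDerivAt
      have h0 : A x - b - e • l = 0 := by
        simpa only [map_eq_zero_iff _ (LinearIsometryEquiv.injective _)] using this
      exact sub_eq_zero.1 h0
  · rintro ⟨h1, h2⟩ u m
    have g1 := strong_convexity_gap hconv (hG x) A b e l u
    have g2 := strong_concavity_gap (A x - b) e l m
    rw [h1, inner_zero_left] at g1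
    rw [h2, sub_self, inner_zero_left] at g2
    rw [h2] at g1 ⊢
    have : 0 ≤ e / 2 * ‖u - x‖ ^ 2 := by positivity
    have : 0 ≤ e / 2 * ‖m - l‖ ^ 2 := by positivity
    linarith

/-! ### Existence of regularized saddle points -/

/-- A continuous function that is bounded below and strongly midpoint convex on a complete space
attains its infimum. -/
theorem exists_minimizer_of_midpoint {φ : X → ℝ} (hφ : Continuous φ) (hb : BddBelow (range φ))
    {e : ℝ} (he : 0 < e)
    (hmid : ∀ x y, φ ((1 / 2 : ℝ) • (x + y)) + e * ‖x - y‖ ^ 2 ≤ (φ x + φ y) / 2) :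
    ∃ x, ∀ y, φ x ≤ φ y := by
  set m := sInf (range φ) with hm
  have hle : ∀ y, m ≤ φ y := fun y => csInf_le hb ⟨y, rfl⟩
  have hex : ∀ n : ℕ, ∃ x, φ x < m + 1 / ((n : ℝ) + 1) := fun n => by
    obtain ⟨_, ⟨x, rfl⟩, hx⟩ := exists_lt_of_csInf_lt (range_nonempty φ)
      (show m < m + 1 / ((n : ℝ) + 1) from lt_add_of_pos_right _ (by positivity))
    exact ⟨x, hx⟩
  choose u hu using hex
  have hlim : Tendsto (fun n : ℕ => 1 / ((n : ℝ) + 1)) atTop (𝓝 0) :=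
    tendsto_one_div_add_atTop_nhds_zero_nat
  -- Midpoints of a minimizing sequence have value at least the infimum, so strong midpoint
  -- convexity forces the terms together.
  have hc : CauchySeq u := by
    rw [Metric.cauchySeq_iff']
    intro ε hε
    obtain ⟨N, hN⟩ := (hlim.eventually_lt_const (show 0 < e * ε ^ 2 by positivity)).exists
    refine ⟨N, fun n hn => ?_⟩
    have h1 := hmid (u n) (u N)
    have h2 := hle ((1 / 2 : ℝ) • (u n + u N))
    have h3 : 1 / ((n : ℝ) + 1) ≤ 1 / ((N : ℝ) + 1) := by gcongr
    have h4 : e * ‖u n - u N‖ ^ 2 < e * ε ^ 2 := by linarith [hu n, hu N]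
    rw [dist_eq_norm]
    exact lt_of_pow_lt_pow_left₀ 2 hε.le (lt_of_mul_lt_mul_left h4 he.le)
  obtain ⟨x, hx⟩ := cauchySeq_tendsto_of_complete hc
  refine ⟨x, fun y => le_trans ?_ (hle y)⟩
  refine le_of_tendsto_of_tendsto ((hφ.tendsto x).comp hx) (b := atTop)
    (f := φ ∘ u) (g := fun n : ℕ => m + 1 / ((n : ℝ) + 1)) ?_
    (Eventually.of_forall fun n => (hu n).le)
  simpa using hlim.const_add m

/-- The dual equation gives l = (A x - b)/e. Substituting it into the primal equation leaves the
stationarity condition of f + e/2 ‖x‖² + ‖A x - b‖²/(2e), which is strongly convex and hence has a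
minimizer. -/
theorem exists_isKKT {f : X → ℝ} (hconv : ConvexOn ℝ univ f) {G : X → X}
    (hG : ∀ x, HasGradientAt f (G x) x) (A : X →L[ℝ] Y) (b : Y) {e : ℝ} (he : 0 < e) :
    ∃ z, IsKKT G A b e z := by
  have hcont : Continuous f := continuous_iff_continuousAt.2 fun x => (hG x).continuousAt
  have hx : ∃ x, ∀ y, f x + e / 2 * ‖x‖ ^ 2 + 1 / (2 * e) * ‖A x - b‖ ^ 2
      ≤ f y + e / 2 * ‖y‖ ^ 2 + 1 / (2 * e) * ‖A y - b‖ ^ 2 := by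
    refine exists_minimizer_of_midpoint
      (φ := fun x => f x + e / 2 * ‖x‖ ^ 2 + 1 / (2 * e) * ‖A x - b‖ ^ 2) (by fun_prop) ?_
      (e := e / 8) (by positivity) ?_
    -- The tangent to `f` at 0 bounds it below by an affine function, and e/2 ‖x‖² absorbs the
    -- linear part.
    · refine ⟨f 0 - ‖G 0‖ ^ 2 / (2 * e), ?_⟩
      rintro _ ⟨x, rfl⟩
      have h1 := inner_gradient_le_sub hconv (hG 0) x
      have h2 := (abs_le.1 (abs_real_inner_le_norm (G 0) (x - 0))).1
      rw [sub_zero] at h1 h2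
      have h3 : 0 ≤ 1 / (2 * e) * ‖A x - b‖ ^ 2 := by positivity
      have h4 : ‖G 0‖ * ‖x‖ ≤ e / 2 * ‖x‖ ^ 2 + ‖G 0‖ ^ 2 / (2 * e) := by
        have : e / 2 * ‖x‖ ^ 2 + ‖G 0‖ ^ 2 / (2 * e) - ‖G 0‖ * ‖x‖
          = (e * ‖x‖ - ‖G 0‖) ^ 2 / (2 * e) := by field_simp; ring
        have : 0 ≤ (e * ‖x‖ - ‖G 0‖) ^ 2 / (2 * e) := by positivity
        linarith
      simp only
      linarith
    · intro x y
      have h1 := hconv.2 (mem_univ x) (mem_univ y) (show (0 : ℝ) ≤ 1 / 2 by norm_num)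
        (show (0 : ℝ) ≤ 1 / 2 by norm_num) (by norm_num)
      rw [← smul_add, smul_eq_mul, smul_eq_mul] at h1
      have h2 := norm_sq_half_smul_add x y
      have h3 := norm_sq_half_smul_add (A x - b) (A y - b)
      have h4 : A ((1 / 2 : ℝ) • (x + y)) - b = (1 / 2 : ℝ) • ((A x - b) + (A y - b)) := by
        rw [map_smul, map_add]; module
      rw [h4, h2, h3]
      have h5 : 0 ≤ 1 / (2 * e) * ‖A x - b - (A y - b)‖ ^ 2 := by positivity
      nlinarith
  obtain ⟨x, hx⟩ := hx
  refine ⟨(x, e⁻¹ • (A x - b)), ?_, ?_⟩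
  · have hd : HasFDerivAt (fun u => f u + e / 2 * ‖u‖ ^ 2 + 1 / (2 * e) * ‖A u - b‖ ^ 2)
        (InnerProductSpace.toDual ℝ X (G x + A.adjoint (e⁻¹ • (A x - b)) + e • x)) x := by
      have h1 := (hG x).hasFDerivAt
      have h2 := ((hasFDerivAt_id x).norm_sq).const_mul (e / 2)
      have h3 := ((A.hasFDerivAt (x := x)).sub_const b).norm_sq.const_mul (1 / (2 * e))
      refine ((h1.add h2).add h3).congr_fderiv ?_
      ext v
      simp [ContinuousLinearMap.adjoint_inner_left]
      field_simp
      ring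
    have hmin : IsLocalMin
        (fun u => f u + e / 2 * ‖u‖ ^ 2 + 1 / (2 * e) * ‖A u - b‖ ^ 2) x :=
      Eventually.of_forall hx
    have := hmin.hasFDerivAt_eq_zero hd
    simpa only [map_eq_zero_iff _ (LinearIsometryEquiv.injective _)] using this
  · simp [smul_smul, he.ne']

theorem monotone_gradient {f : X → ℝ} (hconv : ConvexOn ℝ univ f) {G : X → X}
    (hG : ∀ x, HasGradientAt f (G x) x) (x y : X) : 0 ≤ ⟪G x - G y, x - y⟫_ℝ := by
  have h1 := inner_gradient_le_sub hconv (hG x) y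
  have h2 := inner_gradient_le_sub hconv (hG y) x
  rw [← neg_sub x y, inner_neg_right] at h1
  rw [inner_sub_left]
  linarith

/-! ### Tikhonov regularization of a monotone operator -/

section Monotone

variable {T : X → X}

theorem mul_norm_sub_sq_le_of_regularized_zeros (hT : ∀ u v, 0 ≤ ⟪T u - T v, u - v⟫_ℝ) {z w : X}
    {d e : ℝ} (hz : T z = -(e • z)) (hw : T w = -(d • w)) :
    e * ‖z - w‖ ^ 2 ≤ (d - e) * ⟪w, z - w⟫_ℝ := by
  have h := hT z w
  have h2 : T z - T w = (d - e) • w - e • (z - w) := by rw [hz, hw]; module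
  rw [h2, inner_sub_left, real_inner_smul_left, real_inner_smul_left,
    real_inner_self_eq_norm_sq] at h
  linarith

theorem norm_sub_le_of_regularized_zeros (hT : ∀ u v, 0 ≤ ⟪T u - T v, u - v⟫_ℝ) {z w : X}
    {d e : ℝ} (hz : T z = -(e • z)) (hw : T w = -(d • w)) (he : 0 < e) (hde : e ≤ d) :
    ‖z - w‖ ≤ (d / e - 1) * ‖w‖ := by
  have h := mul_norm_sub_sq_le_of_regularized_zeros hT hz hw
  have h2 : (d - e) * ⟪w, z - w⟫_ℝ ≤ (d - e) * (‖w‖ * ‖z - w‖) :=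
    mul_le_mul_of_nonneg_left (real_inner_le_norm _ _) (by linarith)
  rcases (norm_nonneg (z - w)).eq_or_lt with h0 | h0
  · rw [← h0]
    have : 1 ≤ d / e := (one_le_div he).2 hde
    exact mul_nonneg (by linarith) (norm_nonneg _)
  · have h3 : e * ‖z - w‖ ≤ (d - e) * ‖w‖ := by
      refine le_of_mul_le_mul_right ?_ h0
      nlinarith
    rw [div_sub_one he.ne', div_mul_eq_mul_div, le_div_iff₀ he]
    linarith

/-- Monotonicity tested on z - w makes ⟪w, z - w⟫ nonnegative when the parameter of w is the larger
one. Taking `e = 0` compares a regularized zero with a true zero. -/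
theorem norm_sq_add_norm_sub_sq_le_of_regularized_zeros
    (hT : ∀ u v, 0 ≤ ⟪T u - T v, u - v⟫_ℝ) {z w : X}
    {d e : ℝ} (hz : T z = -(e • z)) (hw : T w = -(d • w)) (he : 0 ≤ e) (hde : e < d) :
    ‖w‖ ^ 2 + ‖z - w‖ ^ 2 ≤ ‖z‖ ^ 2 := by
  have h := mul_norm_sub_sq_le_of_regularized_zeros hT hz hw
  have h1 : 0 ≤ ⟪w, z - w⟫_ℝ := by
    by_contra hneg
    push Not at hneg
    have : (d - e) * ⟪w, z - w⟫_ℝ < 0 := mul_neg_of_pos_of_neg (by linarith) hneg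
    have : 0 ≤ e * ‖z - w‖ ^ 2 := by positivity
    linarith
  linarith [norm_sq_add_inner_le w z]

/-- As the parameter decreases, ‖z_t‖² increases and its increments dominate the squared distances.
It is bounded by the squared norm of any zero of `T`, so the path is Cauchy. The limit is a zero by
continuity, and the Pythagorean inequality against each zero passes to the limit. -/
theorem exists_tendsto_regularized_zeros (hT : ∀ u v, 0 ≤ ⟪T u - T v, u - v⟫_ℝ)
    (hTc : Continuous T) (hne : ∃ z, T z = 0) {t₀ : ℝ} {ε : ℝ → ℝ} (hpos : ∀ t, t₀ ≤ t → 0 < ε t)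
    (hanti : ∀ s t, t₀ ≤ s → s < t → ε t < ε s) (hε : Tendsto ε atTop (𝓝 0)) {z : ℝ → X}
    (hz : ∀ t, t₀ ≤ t → T (z t) = -(ε t • z t)) :
    ∃ w, Tendsto z atTop (𝓝 w) ∧ T w = 0 ∧ ∀ v, T v = 0 → ‖w‖ ^ 2 + ‖v - w‖ ^ 2 ≤ ‖v‖ ^ 2 := by
  have hub : ∀ v, T v = 0 → ∀ t, t₀ ≤ t → ‖z t‖ ^ 2 + ‖v - z t‖ ^ 2 ≤ ‖v‖ ^ 2 := fun v hv t ht =>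
    norm_sq_add_norm_sub_sq_le_of_regularized_zeros hT (e := 0) (by simpa using hv) (hz t ht)
      le_rfl (hpos t ht)
  have hstep : ∀ s t, t₀ ≤ s → s < t → ‖z s‖ ^ 2 + ‖z t - z s‖ ^ 2 ≤ ‖z t‖ ^ 2 :=
    fun s t hs hst => norm_sq_add_norm_sub_sq_le_of_regularized_zeros hT
      (hz t (hs.trans hst.le)) (hz s hs) (hpos t (hs.trans hst.le)).le (hanti s t hs hst)
  obtain ⟨v₀, hv₀⟩ := hne
  set S := (fun t => ‖z t‖ ^ 2) '' Ici t₀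
  have hSb : BddAbove S := by
    refine ⟨‖v₀‖ ^ 2, ?_⟩
    rintro _ ⟨t, ht, rfl⟩
    have := hub v₀ hv₀ t ht
    have : 0 ≤ ‖v₀ - z t‖ ^ 2 := by positivity
    simp only
    linarith
  have hSn : S.Nonempty := ⟨_, t₀, self_mem_Ici, rfl⟩
  have hcauchy : Cauchy (map z atTop) := by
    rw [Metric.cauchy_iff]
    refine ⟨inferInstance, fun δ hδ => ?_⟩
    obtain ⟨_, ⟨s, hs, rfl⟩, hsup⟩ := exists_lt_of_lt_csSup hSn
      (show sSup S - (δ / 2) ^ 2 < sSup S from sub_lt_self _ (by positivity))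
    have hclose : ∀ t, s < t → ‖z t - z s‖ < δ / 2 := fun t ht => by
      have h1 := hstep s t hs ht
      have h2 : ‖z t‖ ^ 2 ≤ sSup S := le_csSup hSb ⟨t, le_trans hs ht.le, rfl⟩
      simp only at hsup
      exact lt_of_pow_lt_pow_left₀ 2 (by positivity) (by linarith)
    refine ⟨z '' Ioi s, image_mem_map (Ioi_mem_atTop s), ?_⟩
    rintro _ ⟨t, ht, rfl⟩ _ ⟨u, hu, rfl⟩
    have h1 := hclose t ht
    have h2 := hclose u hu
    rw [dist_eq_norm, ← sub_sub_sub_cancel_right _ _ (z s)]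
    linarith [norm_sub_le (z t - z s) (z u - z s)]
  obtain ⟨w, hw⟩ := CompleteSpace.complete hcauchy
  have hw : Tendsto z atTop (𝓝 w) := hw
  refine ⟨w, hw, ?_, fun v hv => ?_⟩
  · have h1 : Tendsto (fun t => -(ε t • z t)) atTop (𝓝 0) := by simpa using (hε.smul hw).neg
    refine tendsto_nhds_unique ((hTc.tendsto w).comp hw) (h1.congr' ?_)
    filter_upwards [eventually_ge_atTop t₀] with t ht using (hz t ht).symm
  · refine le_of_tendsto ((hw.norm.pow 2).add ((hw.const_sub v).norm.pow 2)) ?_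
    filter_upwards [eventually_ge_atTop t₀] with t ht using hub v hv t ht

end Monotone

/-! ### The saddle operator on the Hilbert product -/

/-- The monotone operator of the saddle point problem on the Hilbert product. -/
def saddleOperator (G : X → X) (A : X →L[ℝ] Y) (b : Y) (z : WithLp 2 (X × Y)) :
    WithLp 2 (X × Y) :=
  WithLp.toLp 2 (G z.fst + A.adjoint z.snd, b - A z.fst)

/-- The coupling through `A` is skew, so its two contributions cancel and only the monotonicity of
`G` remains. -/
theorem saddleOperator_monotone {G : X → X} (hG : ∀ x y, 0 ≤ ⟪G x - G y, x - y⟫_ℝ)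
    (A : X →L[ℝ] Y) (b : Y) (u v : WithLp 2 (X × Y)) :
    0 ≤ ⟪saddleOperator G A b u - saddleOperator G A b v, u - v⟫_ℝ := by
  rw [WithLp.prod_inner_apply]
  have h := hG u.fst v.fst
  have e1 : (saddleOperator G A b u - saddleOperator G A b v).fst
      = (G u.fst - G v.fst) + A.adjoint (u.snd - v.snd) := by
    change G u.fst + A.adjoint u.snd - (G v.fst + A.adjoint v.snd) = _
    rw [map_sub]; abel
  have e2 : (saddleOperator G A b u - saddleOperator G A b v).snd
      = - A (u.fst - v.fst) := by
    change b - A u.fst - (b - A v.fst) = _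
    rw [map_sub]; abel
  have e3 : (u - v).fst = u.fst - v.fst := rfl
  have e4 : (u - v).snd = u.snd - v.snd := rfl
  change 0 ≤ ⟪(saddleOperator G A b u - saddleOperator G A b v).fst, (u - v).fst⟫_ℝ
    + ⟪(saddleOperator G A b u - saddleOperator G A b v).snd, (u - v).snd⟫_ℝ
  rw [e1, e2, e3, e4, inner_add_left, ContinuousLinearMap.adjoint_inner_left, inner_neg_left,
    real_inner_comm (A _)]
  linarith

theorem saddleOperator_eq_iff (G : X → X) (A : X →L[ℝ] Y) (b : Y) (e : ℝ) (z : X × Y) :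
    saddleOperator G A b (WithLp.toLp 2 z) = -(e • WithLp.toLp 2 z) ↔ IsKKT G A b e z := by
  obtain ⟨x, l⟩ := z
  have : saddleOperator G A b (WithLp.toLp 2 (x, l)) = -(e • WithLp.toLp 2 (x, l)) ↔
      (G x + A.adjoint l = -(e • x) ∧ b - A x = -(e • l)) := by
    rw [← WithLp.toLp_smul, ← WithLp.toLp_neg, saddleOperator,
      (WithLp.toLp_injective 2).eq_iff, Prod.ext_iff]
    rfl
  rw [this, IsKKT]
  refine and_congr add_eq_zero_iff_eq_neg.symm ?_
  rw [← neg_sub, neg_inj]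

theorem saddleOperator_continuous {G : X → X} (hG : Continuous G) (A : X →L[ℝ] Y) (b : Y) :
    Continuous (saddleOperator G A b) := by
  unfold saddleOperator
  have h1 : Continuous (fun z : WithLp 2 (X × Y) => z.fst) :=
    continuous_fst.comp (WithLp.prod_continuous_ofLp 2 X Y)
  have h2 : Continuous (fun z : WithLp 2 (X × Y) => z.snd) :=
    continuous_snd.comp (WithLp.prod_continuous_ofLp 2 X Y)
  refine (WithLp.prod_continuous_toLp 2 X Y).comp ?_
  fun_prop

theorem norm_fst_le_pairNorm (z : X × Y) : ‖z.1‖ ≤ pairNorm z := by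
  have h := WithLp.prod_norm_sq_eq_of_L2 (WithLp.toLp 2 z)
  refine le_of_sq_le_sq ?_ (norm_nonneg _)
  rw [pairNorm, h]
  simp

theorem norm_snd_le_pairNorm (z : X × Y) : ‖z.2‖ ≤ pairNorm z := by
  have h := WithLp.prod_norm_sq_eq_of_L2 (WithLp.toLp 2 z)
  refine le_of_sq_le_sq ?_ (norm_nonneg _)
  rw [pairNorm, h]
  simp

theorem pairNorm_le (z : X × Y) : pairNorm z ≤ ‖z.1‖ + ‖z.2‖ := by
  have h := WithLp.prod_norm_sq_eq_of_L2 (WithLp.toLp 2 z)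
  refine le_of_sq_le_sq ?_ (by positivity)
  rw [pairNorm, h]
  have : 0 ≤ ‖z.1‖ * ‖z.2‖ := by positivity
  change ‖z.1‖ ^ 2 + ‖z.2‖ ^ 2 ≤ _
  nlinarith

theorem IsKKT.pairNorm_le {G : X → X} (hG : ∀ x y, 0 ≤ ⟪G x - G y, x - y⟫_ℝ)
    {A : X →L[ℝ] Y} {b : Y} {e : ℝ} {z w : X × Y} (he : 0 < e) (hz : IsKKT G A b e z)
    (hw : IsKKT G A b 0 w) : pairNorm z ≤ pairNorm w := by
  rw [← saddleOperator_eq_iff] at hz hw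
  have := norm_sq_add_norm_sub_sq_le_of_regularized_zeros
    (saddleOperator_monotone hG A b) hw hz le_rfl he
  refine le_of_sq_le_sq ?_ (norm_nonneg _)
  rw [pairNorm, pairNorm]
  nlinarith [sq_nonneg ‖WithLp.toLp 2 w - WithLp.toLp 2 z‖]

theorem IsKKT.pairNorm_sub_le {G : X → X} (hG : ∀ x y, 0 ≤ ⟪G x - G y, x - y⟫_ℝ)
    {A : X →L[ℝ] Y} {b : Y} {d e : ℝ} {z w : X × Y} (he : 0 < e) (hde : e ≤ d)
    (hz : IsKKT G A b e z) (hw : IsKKT G A b d w) :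
    pairNorm (z - w) ≤ (d / e - 1) * pairNorm w := by
  rw [← saddleOperator_eq_iff] at hz hw
  exact norm_sub_le_of_regularized_zeros (saddleOperator_monotone hG A b) hz hw he hde

theorem IsKKT.unique {G : X → X} (hG : ∀ x y, 0 ≤ ⟪G x - G y, x - y⟫_ℝ)
    {A : X →L[ℝ] Y} {b : Y} {e : ℝ} {z w : X × Y} (he : 0 < e)
    (hz : IsKKT G A b e z) (hw : IsKKT G A b e w) : z = w := by
  have h := hz.pairNorm_sub_le hG he le_rfl hw
  rw [div_self he.ne', sub_self, zero_mul] at h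
  have h1 := (norm_fst_le_pairNorm (z - w)).trans h
  have h2 := (norm_snd_le_pairNorm (z - w)).trans h
  rw [norm_le_zero_iff] at h1 h2
  exact sub_eq_zero.1 (Prod.ext h1 h2)

theorem exists_tendsto_isKKT {G : X → X} (hG : ∀ x y, 0 ≤ ⟪G x - G y, x - y⟫_ℝ)
    (hGc : Continuous G) {A : X →L[ℝ] Y} {b : Y} (hne : ∃ z, IsKKT G A b 0 z) {t₀ : ℝ} {ε : ℝ → ℝ}
    (hpos : ∀ t, t₀ ≤ t → 0 < ε t) (hanti : ∀ s t, t₀ ≤ s → s < t → ε t < ε s)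
    (hε : Tendsto ε atTop (𝓝 0)) {z : ℝ → X × Y} (hz : ∀ t, t₀ ≤ t → IsKKT G A b (ε t) (z t)) :
    ∃ w, IsKKT G A b 0 w ∧ Tendsto (fun t => pairNorm (z t - w)) atTop (𝓝 0) ∧
      ∀ v, IsKKT G A b 0 v → pairNorm w ^ 2 + pairNorm (v - w) ^ 2 ≤ pairNorm v ^ 2 := by
  have h0 : ∀ v : X × Y, saddleOperator G A b (WithLp.toLp 2 v) = 0 ↔ IsKKT G A b 0 v :=
    fun v => by rw [← saddleOperator_eq_iff, zero_smul, neg_zero]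
  obtain ⟨z₀, hz₀⟩ := hne
  obtain ⟨w, hw1, hw2, hw3⟩ := exists_tendsto_regularized_zeros (saddleOperator_monotone hG A b)
    (saddleOperator_continuous hGc A b) ⟨WithLp.toLp 2 z₀, (h0 _).2 hz₀⟩ hpos hanti hε
    (z := fun t => WithLp.toLp 2 (z t)) fun t ht => (saddleOperator_eq_iff _ _ _ _ _).2 (hz t ht)
  refine ⟨WithLp.ofLp w, (h0 _).1 hw2, ?_, fun v hv => hw3 _ ((h0 _).2 hv)⟩
  exact tendsto_iff_norm_sub_tendsto_zero.1 hw1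

/-! ### A comparison principle for a non-differentiable energy -/

theorem eventually_mul_rpow_le {k : ℝ} (hk : k < 0) (C : ℝ) {η : ℝ} (hη : 0 < η) :
    ∀ᶠ t : ℝ in atTop, C * t ^ k ≤ η := by
  have h : Tendsto (fun t : ℝ => C * t ^ k) atTop (𝓝 0) := by
    have := (tendsto_rpow_neg_atTop (neg_pos.2 hk)).const_mul C
    simpa using this
  filter_upwards [h.eventually_lt_const hη] with t ht using ht.le

/-- If a continuous `E` has, at each time `t`, a local majorant touching it at `t` whose right
derivative there is at most `-κ t ^ (-r) E + C t ^ m`, then `E = O(t ^ (m + r))`. -/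
theorem exists_le_mul_rpow_of_dissipative_majorant {E : ℝ → ℝ} {T κ C r m : ℝ} (hκ : 0 < κ)
    (hr : r < 1) (hE : ContinuousOn E (Ici T))
    (h : ∀ t, T ≤ t → ∃ (F : ℝ → ℝ) (g : ℝ), HasDerivAt F g t ∧ F t = E t ∧
      (∀ᶠ τ in 𝓝[>] t, E τ ≤ F τ) ∧ g ≤ -κ * (t ^ (-r) * E t) + C * t ^ m) :
    ∃ K, ∀ᶠ t in atTop, E t ≤ K * t ^ (m + r) := by
  obtain ⟨S, hS⟩ := eventually_atTop.1
    (eventually_mul_rpow_le (sub_neg.2 hr) |m + r| (show 0 < κ / 2 by positivity))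
  set T₁ := max (max T S) 1 with hT₁
  have hT : T ≤ T₁ := (le_max_left _ _).trans (le_max_left _ _)
  have hST : S ≤ T₁ := (le_max_right _ _).trans (le_max_left _ _)
  have hT1 : 1 ≤ T₁ := le_max_right _ _
  -- The first entry starts the barrier above `E`. The second makes κ K exceed 2|C|, so that half of
  -- the decay term beats the source; the other half pays for the derivative of the barrier, which
  -- is negligible beyond `T₁` because r < 1.
  set K := max (E T₁ / T₁ ^ (m + r)) ((2 * |C| + 1) / κ) with hK
  have hK2 : 2 * |C| + 1 ≤ κ * K := by
    have : (2 * |C| + 1) / κ ≤ K := le_max_right _ _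
    rw [div_le_iff₀ hκ] at this
    linarith
  have hKpos : 0 < K := lt_of_lt_of_le (by positivity) (le_max_right _ _)
  have hKE : E T₁ ≤ K * T₁ ^ (m + r) := by
    have : E T₁ / T₁ ^ (m + r) ≤ K := le_max_left _ _
    rwa [div_le_iff₀ (Real.rpow_pos_of_pos (by linarith) _)] at this
  have hpos : ∀ t, T₁ ≤ t → 0 < t := fun t ht => by linarith
  refine ⟨K, ?_⟩
  filter_upwards [eventually_ge_atTop T₁] with b hb
  have hB : ∀ t, T₁ ≤ t → HasDerivAt (fun t : ℝ => K * t ^ (m + r))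
      (K * ((m + r) * t ^ (m + r - 1))) t := fun t ht =>
    (Real.hasDerivAt_rpow_const (Or.inl (hpos t ht).ne')).const_mul K
  refine image_le_of_liminf_slope_right_lt_deriv_boundary' (a := T₁) (b := b)
    (f' := fun t => -κ * (t ^ (-r) * E t) + C * t ^ m)
    (hE.mono fun t ht => hT.trans ht.1) ?_ hKE
    (B' := fun t => K * ((m + r) * t ^ (m + r - 1)))
    (fun t ht => (hB t ht.1).continuousAt.continuousWithinAt)
    (fun t ht => (hB t ht.1).hasDerivWithinAt) ?_ ⟨hb, le_rfl⟩
  · intro t ht ρ hρ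
    obtain ⟨F, g, hF, hFt, hle, hg⟩ := h t (hT.trans ht.1)
    have h1 := (hasDerivWithinAt_iff_tendsto_slope' (s := Ioi t) (by simp)).1 hF.hasDerivWithinAt
    refine Eventually.frequently ?_
    filter_upwards [h1.eventually_lt_const (hg.trans_lt hρ), hle, self_mem_nhdsWithin]
      with τ h2 h3 h4
    have h5 : 0 < τ - t := sub_pos.2 h4
    rw [slope_def_field] at h2 ⊢
    refine lt_of_le_of_lt ?_ h2
    rw [hFt]
    gcongr
  -- At a contact point `E` equals the barrier. After division by t^m the required strict inequality
  -- is -κ K + C < K (m + r) t^(r-1).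
  · intro t ht heq
    have h0 := hpos t ht.1
    have h1 := hS t (hST.trans ht.1)
    have e1 : t ^ (-r) * E t = K * t ^ m := by
      rw [heq, mul_left_comm, ← Real.rpow_add h0]
      ring_nf
    have e2 : t ^ (m + r - 1) = t ^ m * t ^ (r - 1) := by
      rw [← Real.rpow_add h0]; ring_nf
    have hm : 0 < t ^ m := Real.rpow_pos_of_pos h0 _
    have hr1 : 0 < t ^ (r - 1) := Real.rpow_pos_of_pos h0 _
    rw [e1, e2]
    have h2 : -(κ / 2) ≤ (m + r) * t ^ (r - 1) := by
      have := neg_abs_le (m + r)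
      nlinarith
    have h3 : C ≤ |C| := le_abs_self C
    have h4 : K * (-(κ / 2)) ≤ K * ((m + r) * t ^ (r - 1)) :=
      mul_le_mul_of_nonneg_left h2 hKpos.le
    have h5 : -κ * K + C < K * ((m + r) * t ^ (r - 1)) := by linarith
    nlinarith

/-! ### Moving the regularized saddle point, and the dissipation identity -/

/-- The regularized Lagrangian with regularization parameter `e`. -/
def regL (f : X → ℝ) (A : X →L[ℝ] Y) (b : Y) (e : ℝ) (x : X) (l : Y) : ℝ :=
  f x + ⟪l, A x - b⟫_ℝ + e / 2 * (‖x‖ ^ 2 - ‖l‖ ^ 2)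

theorem regL_sub_eq_dual {f : X → ℝ} {A : X →L[ℝ] Y} {b : Y} {e : ℝ} {x : X} {l m : Y} :
    regL f A b e x m = regL f A b e x l + ⟪m - l, A x - b - e • l⟫_ℝ - e / 2 * ‖m - l‖ ^ 2 := by
  have h := strong_concavity_gap (A x - b) e l m
  rw [real_inner_comm (m - l)] at h
  simp only [regL]
  linarith

theorem IsKKT.regL_le {f : X → ℝ} {G : X → X} (hconv : ConvexOn ℝ univ f)
    (hG : ∀ x, HasGradientAt f (G x) x) {A : X →L[ℝ] Y} {b : Y} {e : ℝ} {x : X} {l : Y}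
    (h : IsKKT G A b e (x, l)) (y : X) :
    regL f A b e x l + e / 2 * ‖y - x‖ ^ 2 ≤ regL f A b e y l := by
  have := strong_convexity_gap hconv (hG x) A b e l y
  rw [show G x + A.adjoint l + e • x = 0 from h.1, inner_zero_left] at this
  simp only [regL]
  linarith

theorem two_mul_le_add_of_young (δ a b : ℝ) (hδ : 0 < δ) : 2 * (a * b) ≤ δ * a ^ 2 + b ^ 2 / δ := by
  have : δ * a ^ 2 + b ^ 2 / δ - 2 * (a * b) = (δ * a - b) ^ 2 / δ := by field_simp; ring
  have : 0 ≤ (δ * a - b) ^ 2 / δ := by positivity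
  linarith

/-- Cost of exchanging the saddle point at parameter `d` for the one at a larger parameter `e`. The
change of multiplier is exactly quadratic and pairs l₂ - l₁ with A (y - x₁) + (e - d) l₁; Young's
inequality with `δ` separates ‖A‖ from ‖y - x₁‖. -/
theorem regL_gap_le_of_isKKT {f : X → ℝ} {G : X → X} (hconv : ConvexOn ℝ univ f)
    (hG : ∀ x, HasGradientAt f (G x) x) {A : X →L[ℝ] Y} {b : Y} {d e M ρ δ : ℝ}
    {x₁ x₂ : X} {l₁ l₂ : Y} (h₁ : IsKKT G A b e (x₁, l₁)) (h₂ : IsKKT G A b d (x₂, l₂))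
    (hd : 0 ≤ d) (hde : d ≤ e) (hx : ‖x₂‖ ≤ M) (hl : ‖l₁‖ ≤ M) (hρ : ‖l₂ - l₁‖ ≤ ρ) (hδ : 0 < δ)
    (y : X) :
    regL f A b d y l₂ - regL f A b d x₂ l₂ ≤ regL f A b e y l₁ - regL f A b e x₁ l₁
      + (e - d) / 2 * M ^ 2 + ρ * (δ / 2 * ‖y - x₁‖ ^ 2 + ‖A‖ ^ 2 / (2 * δ))
      + ρ * ((e - d) * M) := by
  have hρ0 : 0 ≤ ρ := (norm_nonneg _).trans hρ
  have hM : 0 ≤ M := (norm_nonneg _).trans hx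
  have a1 := regL_sub_eq_dual (f := f) (A := A) (b := b) (e := d) (x := y) (l := l₁) (m := l₂)
  have a2 := regL_sub_eq_dual (f := f) (A := A) (b := b) (e := d) (x := x₂) (l := l₂) (m := l₁)
  rw [show A x₂ - b - d • l₂ = 0 from sub_eq_zero.2 h₂.2, inner_zero_right] at a2
  have a3 := h₁.regL_le hconv hG x₂
  have a4 : A y - b - d • l₁ = A (y - x₁) + (e - d) • l₁ := by
    have : A x₁ - b = e • l₁ := h₁.2
    rw [map_sub, sub_smul, ← this]; abel
  have a5 : ⟪l₂ - l₁, A y - b - d • l₁⟫_ℝ ≤ ρ * (‖A‖ * ‖y - x₁‖ + (e - d) * M) := by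
    refine (real_inner_le_norm _ _).trans (mul_le_mul hρ ?_ (norm_nonneg _) hρ0)
    rw [a4]
    refine (norm_add_le _ _).trans (add_le_add (A.le_opNorm _) ?_)
    rw [norm_smul, Real.norm_of_nonneg (sub_nonneg.2 hde)]
    exact mul_le_mul_of_nonneg_left hl (sub_nonneg.2 hde)
  have a6 : ‖A‖ * ‖y - x₁‖ ≤ δ / 2 * ‖y - x₁‖ ^ 2 + ‖A‖ ^ 2 / (2 * δ) := by
    have := two_mul_le_add_of_young δ ‖y - x₁‖ ‖A‖ hδ
    have e1 : ‖A‖ ^ 2 / (2 * δ) = ‖A‖ ^ 2 / δ / 2 := by rw [mul_comm, div_mul_eq_div_div]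
    rw [e1]
    linarith
  have a7 := mul_le_mul_of_nonneg_left a6 hρ0
  have a8 : 0 ≤ d / 2 * ‖l₂ - l₁‖ ^ 2 := by positivity
  have a9 : 0 ≤ d / 2 * ‖l₁ - l₂‖ ^ 2 := by positivity
  have a10 : 0 ≤ e / 2 * ‖x₂ - x₁‖ ^ 2 := by
    have : 0 ≤ e := hd.trans hde
    positivity
  have a11 : (e - d) * ‖x₂‖ ^ 2 ≤ (e - d) * M ^ 2 := by
    have := sub_nonneg.2 hde
    gcongr
  have a12 : 0 ≤ (e - d) * ‖y‖ ^ 2 := mul_nonneg (sub_nonneg.2 hde) (sq_nonneg _)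
  simp only [regL] at *
  linarith

theorem norm_add_sq_le_of_young {w d : X} {ρ K : ℝ} (hd : ‖d‖ ≤ ρ) (hK : 0 < K) :
    ‖w + d‖ ^ 2 ≤ (1 + K * ρ) * ‖w‖ ^ 2 + ρ / K + ρ ^ 2 := by
  have h0 : 0 ≤ ρ := (norm_nonneg _).trans hd
  have h1 : ‖w + d‖ ≤ ‖w‖ + ρ := (norm_add_le _ _).trans (by linarith)
  have h2 : ‖w + d‖ ^ 2 ≤ (‖w‖ + ρ) ^ 2 := by gcongr
  have h3 := mul_le_mul_of_nonneg_left (two_mul_le_add_of_young K ‖w‖ 1 hK) h0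
  have : ρ / K = ρ * (1 ^ 2 / K) := by rw [one_pow, mul_one_div]
  rw [this]
  nlinarith

/-- Here w = x - x_t, μ = l - l_t, and n is the primal gradient at multiplier l_t. The derivatives
of the four parts of the energy are arranged so that the terms in ⟪w, v⟫, ⟪n, v⟫ and the coupling
through `A` cancel. The extrapolated point x + θ t^q v in the dual equation is what cancels the
coupling. -/
theorem inner_dissipation (A : X →L[ℝ] Y) (w v n : X) (μ : Y) (θ g Q S e : ℝ) :
    ⟪w + (θ * Q) • v, -(g • v) - (θ * S) • (n + A.adjoint μ)⟫_ℝ + g * ⟪w, v⟫_ℝ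
      + θ * ⟪μ, S • (A (w + (θ * Q) • v) - e • μ)⟫_ℝ + θ ^ 2 * (Q * S) * ⟪n, v⟫_ℝ
      = -(g * θ * (Q * ‖v‖ ^ 2)) - θ * S * ⟪n, w⟫_ℝ - θ * (S * e * ‖μ‖ ^ 2) := by
  have h1 : ∀ y : X, ⟪y, A.adjoint μ⟫_ℝ = ⟪μ, A y⟫_ℝ := fun y => by
    rw [ContinuousLinearMap.adjoint_inner_right, real_inner_comm]
  simp only [inner_add_left, inner_sub_right, inner_add_right, inner_neg_right,
    real_inner_smul_left, real_inner_smul_right, h1, map_add, map_smul,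
    real_inner_self_eq_norm_sq, real_inner_comm n]
  rw [real_inner_comm v w]
  ring

/-! ### Regularity of the path of regularized saddle points -/

/-- The data of the regularized flow in differentiated form, together with the path of regularized
saddle points. -/
structure IsRegularizedFlow (f : X → ℝ) (G : X → X) (A : X →L[ℝ] Y) (b : Y)
    (α θ q p s c t₀ M : ℝ) (xr : ℝ → X) (lr : ℝ → Y) (x v : ℝ → X) (l : ℝ → Y) : Prop where
  convex : ConvexOn ℝ univ f
  grad : ∀ x, HasGradientAt f (G x) x
  kkt : ∀ t, t₀ ≤ t → IsKKT G A b (c / t ^ p) (xr t, lr t)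
  bound : ∀ t, t₀ ≤ t → pairNorm (xr t, lr t) ≤ M
  deriv_x : ∀ t, t₀ < t → HasDerivAt x (v t) t
  deriv_v : ∀ t, t₀ < t → HasDerivAt v (-((α / t ^ q) • v t)
    - t ^ s • (G (x t) + A.adjoint (l t) + (c / t ^ p) • x t)) t
  deriv_l : ∀ t, t₀ < t → HasDerivAt l
    (t ^ (q + s) • (A (x t + (θ * t ^ q) • v t) - b - (c / t ^ p) • l t)) t

namespace IsRegularizedFlow

variable {f : X → ℝ} {G : X → X} {A : X →L[ℝ] Y} {b : Y} {α θ q p s c t₀ M : ℝ}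
  {xr : ℝ → X} {lr : ℝ → Y} {x v : ℝ → X} {l : ℝ → Y}

theorem norm_xr_le (h : IsRegularizedFlow f G A b α θ q p s c t₀ M xr lr x v l) {t : ℝ}
    (ht : t₀ ≤ t) : ‖xr t‖ ≤ M := (norm_fst_le_pairNorm _).trans (h.bound t ht)

theorem norm_lr_le (h : IsRegularizedFlow f G A b α θ q p s c t₀ M xr lr x v l) {t : ℝ}
    (ht : t₀ ≤ t) : ‖lr t‖ ≤ M := (norm_snd_le_pairNorm _).trans (h.bound t ht)

theorem param_anti (hc : 0 < c) (hp : 0 < p) {t τ : ℝ} (ht : 0 < t) (hτ : t ≤ τ) :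
    c / τ ^ p ≤ c / t ^ p := by
  gcongr

theorem pairNorm_sub_le (h : IsRegularizedFlow f G A b α θ q p s c t₀ M xr lr x v l)
    (hc : 0 < c) (hp : 0 < p) (ht₀ : 0 < t₀) {t τ : ℝ} (ht : t₀ ≤ t) (hτ : t ≤ τ) :
    pairNorm ((xr τ, lr τ) - (xr t, lr t)) ≤ (τ ^ p / t ^ p - 1) * M := by
  have h0 : 0 < t := ht₀.trans_le ht
  have h1 : 0 < τ := h0.trans_le hτ
  have h2 : 0 < t ^ p := Real.rpow_pos_of_pos h0 _
  have h3 : 0 < τ ^ p := Real.rpow_pos_of_pos h1 _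
  have h4 := (h.kkt τ (ht.trans hτ)).pairNorm_sub_le (monotone_gradient h.convex h.grad)
    (by positivity) (param_anti hc hp h0 hτ) (h.kkt t ht)
  have h5 : c / t ^ p / (c / τ ^ p) = τ ^ p / t ^ p := by field_simp
  rw [h5] at h4
  refine h4.trans (mul_le_mul_of_nonneg_left (h.bound t ht) ?_)
  rw [sub_nonneg, one_le_div h2]
  gcongr

/-- The estimate of the path is one-sided in time. Adding it with the times exchanged gives a bound
valid in either order, from which continuity of the path follows. -/
theorem pairNorm_sub_le_abs (h : IsRegularizedFlow f G A b α θ q p s c t₀ M xr lr x v l)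
    (hc : 0 < c) (hp : 0 < p) (ht₀ : 0 < t₀) {t τ : ℝ} (ht : t₀ ≤ t) (hτ : t₀ ≤ τ) :
    pairNorm ((xr τ, lr τ) - (xr t, lr t)) ≤ |τ ^ p / t ^ p - 1| * M + |t ^ p / τ ^ p - 1| * M := by
  have hM : 0 ≤ M := (norm_nonneg _).trans (h.norm_xr_le ht)
  have n1 : 0 ≤ |τ ^ p / t ^ p - 1| * M := by positivity
  have n2 : 0 ≤ |t ^ p / τ ^ p - 1| * M := by positivity
  rcases le_total t τ with hle | hle
  · have h1 := h.pairNorm_sub_le hc hp ht₀ ht hle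
    have h2 := mul_le_mul_of_nonneg_right (le_abs_self (τ ^ p / t ^ p - 1)) hM
    linarith
  · have h1 := h.pairNorm_sub_le hc hp ht₀ hτ hle
    have h2 := mul_le_mul_of_nonneg_right (le_abs_self (t ^ p / τ ^ p - 1)) hM
    have h3 : pairNorm ((xr τ, lr τ) - (xr t, lr t)) = pairNorm ((xr t, lr t) - (xr τ, lr τ)) := by
      simp only [pairNorm, WithLp.toLp_sub]
      exact norm_sub_rev _ _
    linarith

theorem tendsto_pairNorm_sub (h : IsRegularizedFlow f G A b α θ q p s c t₀ M xr lr x v l)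
    (hc : 0 < c) (hp : 0 < p) (ht₀ : 0 < t₀) {t : ℝ} (ht : t₀ ≤ t) :
    Tendsto (fun τ => pairNorm ((xr τ, lr τ) - (xr t, lr t))) (𝓝[Ici t₀] t) (𝓝 0) := by
  have h0 : t ≠ 0 := (ht₀.trans_le ht).ne'
  have h1 : t ^ p ≠ 0 := (Real.rpow_pos_of_pos (ht₀.trans_le ht) _).ne'
  have hc1 : ContinuousAt (fun τ : ℝ => |τ ^ p / t ^ p - 1| * M + |t ^ p / τ ^ p - 1| * M) t := by
    have : ContinuousAt (fun τ : ℝ => τ ^ p) t := Real.continuousAt_rpow_const _ _ (Or.inl h0)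
    fun_prop (disch := assumption)
  have hc2 := hc1.tendsto.mono_left (nhdsWithin_le_nhds (s := Ici t₀))
  simp only [div_self h1, sub_self, abs_zero, zero_mul, add_zero] at hc2
  refine squeeze_zero' (Eventually.of_forall fun τ => norm_nonneg _) ?_ hc2
  filter_upwards [self_mem_nhdsWithin] with τ hτ using h.pairNorm_sub_le_abs hc hp ht₀ ht hτ

theorem continuousOn_xr (h : IsRegularizedFlow f G A b α θ q p s c t₀ M xr lr x v l)
    (hc : 0 < c) (hp : 0 < p) (ht₀ : 0 < t₀) : ContinuousOn xr (Ici t₀) := fun t ht =>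
  tendsto_iff_norm_sub_tendsto_zero.2 <| squeeze_zero (fun _ => norm_nonneg _)
    (fun τ => norm_fst_le_pairNorm ((xr τ, lr τ) - (xr t, lr t)))
    (h.tendsto_pairNorm_sub hc hp ht₀ ht)

theorem continuousOn_lr (h : IsRegularizedFlow f G A b α θ q p s c t₀ M xr lr x v l)
    (hc : 0 < c) (hp : 0 < p) (ht₀ : 0 < t₀) : ContinuousOn lr (Ici t₀) := fun t ht =>
  tendsto_iff_norm_sub_tendsto_zero.2 <| squeeze_zero (fun _ => norm_nonneg _)
    (fun τ => norm_snd_le_pairNorm ((xr τ, lr τ) - (xr t, lr t)))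
    (h.tendsto_pairNorm_sub hc hp ht₀ ht)

end IsRegularizedFlow

/-! ### The Lyapunov function and its touching majorants -/

/-- The coefficient of `‖x - x_t‖ ^ 2 / 2` in the energy. -/
def damping (α θ q t : ℝ) : ℝ := α * θ - 1 - θ * q * t ^ (q - 1)

/-- The Lyapunov function of the regularized flow. -/
def energy (f : X → ℝ) (A : X →L[ℝ] Y) (b : Y) (α θ q p s c : ℝ) (xr : ℝ → X) (lr : ℝ → Y)
    (x v : ℝ → X) (l : ℝ → Y) (t : ℝ) : ℝ :=
  θ ^ 2 * t ^ (2 * q + s) *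
      (regL f A b (c / t ^ p) (x t) (lr t) - regL f A b (c / t ^ p) (xr t) (lr t))
    + 1 / 2 * ‖x t - xr t + (θ * t ^ q) • v t‖ ^ 2
    + 1 / 2 * damping α θ q t * ‖x t - xr t‖ ^ 2 + θ / 2 * ‖l t - lr t‖ ^ 2

/-- A majorant of the energy touching it when `ρ = 0`. -/
def majorant (θ M N δ K e P D ε ρ U g a w : ℝ) : ℝ :=
  θ ^ 2 * P * (D + (e - ε) / 2 * M ^ 2 + ρ * (δ / 2 * a + N ^ 2 / (2 * δ)) + ρ * ((e - ε) * M))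
    + 1 / 2 * ((1 + K * ρ) * U + ρ / K + ρ ^ 2)
    + 1 / 2 * g * ((1 + K * ρ) * a + ρ / K + ρ ^ 2)
    + θ / 2 * ((1 + K * ρ) * w + ρ / K + ρ ^ 2)

/-- At the touching time ρ = 0 and ε = e, so terms in ρ² and ρ (e - ε) do not contribute: the drift
appears only linearly, through ρ'. -/
theorem hasDerivAt_majorant {θ M N δ K e t : ℝ} {P D ε ρ U g a w : ℝ → ℝ}
    {P' D' ε' ρ' U' g' a' w' : ℝ} (hP : HasDerivAt P P' t) (hD : HasDerivAt D D' t)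
    (hε : HasDerivAt ε ε' t) (hρ : HasDerivAt ρ ρ' t) (hU : HasDerivAt U U' t)
    (hg : HasDerivAt g g' t) (ha : HasDerivAt a a' t) (hw : HasDerivAt w w' t)
    (hρ0 : ρ t = 0) (hε0 : ε t = e) :
    HasDerivAt (fun τ => majorant θ M N δ K e (P τ) (D τ) (ε τ) (ρ τ) (U τ) (g τ) (a τ) (w τ))
      (θ ^ 2 * P' * D t
        + θ ^ 2 * P t * (D' - ε' / 2 * M ^ 2 + ρ' * (δ / 2 * a t + N ^ 2 / (2 * δ)))
        + 1 / 2 * (U' + ρ' * (K * U t + 1 / K))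
        + 1 / 2 * g' * a t + 1 / 2 * g t * (a' + ρ' * (K * a t + 1 / K))
        + θ / 2 * (w' + ρ' * (K * w t + 1 / K))) t := by
  have young : ∀ {z : ℝ → ℝ} {z' : ℝ}, HasDerivAt z z' t →
      HasDerivAt (fun τ => (1 + K * ρ τ) * z τ + ρ τ / K + ρ τ ^ 2)
        (z' + ρ' * (K * z t + 1 / K)) t := fun {z z'} hz => by
    have := ((((hρ.const_mul K).const_add 1).mul hz).add (hρ.div_const K)).add (hρ.pow 2)
    refine this.congr_deriv ?_
    rw [hρ0]
    simp
    ring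
  have h1 : HasDerivAt (fun τ => D τ + (e - ε τ) / 2 * M ^ 2
      + ρ τ * (δ / 2 * a τ + N ^ 2 / (2 * δ)) + ρ τ * ((e - ε τ) * M))
      (D' - ε' / 2 * M ^ 2 + ρ' * (δ / 2 * a t + N ^ 2 / (2 * δ))) t := by
    have := ((hD.add (((hε.const_sub e).div_const 2).mul_const (M ^ 2))).add
      (hρ.mul ((ha.const_mul (δ / 2)).add_const (N ^ 2 / (2 * δ))))).add
      (hρ.mul ((hε.const_sub e).mul_const M))
    refine this.congr_deriv ?_
    rw [hρ0, hε0]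
    ring
  have h2 := ((((hP.const_mul (θ ^ 2)).mul h1).add ((young hU).const_mul (1 / 2))).add
    ((hg.const_mul (1 / 2)).mul (young ha))).add ((young hw).const_mul (θ / 2))
  refine h2.congr_deriv ?_
  simp only [hρ0, hε0]
  ring

namespace IsRegularizedFlow

variable {f : X → ℝ} {G : X → X} {A : X →L[ℝ] Y} {b : Y} {α θ q p s c t₀ M : ℝ}
  {xr : ℝ → X} {lr : ℝ → Y} {x v : ℝ → X} {l : ℝ → Y}

theorem energy_le_majorant (h : IsRegularizedFlow f G A b α θ q p s c t₀ M xr lr x v l)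
    (hc : 0 < c) (hp : 0 < p) (ht₀ : 0 < t₀) (hθ : 0 ≤ θ) {t τ δ K : ℝ} (hδ : 0 < δ) (hK : 0 < K)
    (ht : t₀ ≤ t) (hτ : t ≤ τ) (hg : 0 ≤ damping α θ q τ) :
    energy f A b α θ q p s c xr lr x v l τ ≤
      majorant θ M ‖A‖ δ K (c / t ^ p) (τ ^ (2 * q + s))
        (regL f A b (c / t ^ p) (x τ) (lr t) - regL f A b (c / t ^ p) (xr t) (lr t))
        (c / τ ^ p) ((τ ^ p / t ^ p - 1) * M) (‖x τ - xr t + (θ * τ ^ q) • v τ‖ ^ 2)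
        (damping α θ q τ) (‖x τ - xr t‖ ^ 2) (‖l τ - lr t‖ ^ 2) := by
  have h0 : 0 < t := ht₀.trans_le ht
  have h1 : 0 < τ := h0.trans_le hτ
  have hz := h.pairNorm_sub_le hc hp ht₀ ht hτ
  have hx : ‖xr τ - xr t‖ ≤ (τ ^ p / t ^ p - 1) * M :=
    (norm_fst_le_pairNorm ((xr τ, lr τ) - (xr t, lr t))).trans hz
  have hl : ‖lr τ - lr t‖ ≤ (τ ^ p / t ^ p - 1) * M :=
    (norm_snd_le_pairNorm ((xr τ, lr τ) - (xr t, lr t))).trans hz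
  have hgap := regL_gap_le_of_isKKT h.convex h.grad (h.kkt t ht) (h.kkt τ (ht.trans hτ))
    (by positivity) (param_anti hc hp h0 hτ) (h.norm_xr_le (ht.trans hτ)) (h.norm_lr_le ht) hl hδ
    (x τ)
  have hx' : ‖xr t - xr τ‖ ≤ (τ ^ p / t ^ p - 1) * M := by rwa [norm_sub_rev]
  have hl' : ‖lr t - lr τ‖ ≤ (τ ^ p / t ^ p - 1) * M := by rwa [norm_sub_rev]
  have y1 := norm_add_sq_le_of_young (w := x τ - xr t + (θ * τ ^ q) • v τ) hx' hK
  have y2 := norm_add_sq_le_of_young (w := x τ - xr t) hx' hK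
  have y3 := norm_add_sq_le_of_young (w := l τ - lr t) hl' hK
  rw [show x τ - xr t + (θ * τ ^ q) • v τ + (xr t - xr τ)
    = x τ - xr τ + (θ * τ ^ q) • v τ by abel] at y1
  rw [sub_add_sub_cancel] at y2 y3
  rw [energy, majorant]
  gcongr

/-- With the saddle point frozen at time t, every ingredient of the majorant is differentiable, and
the bound on its derivative consists of the dissipation, the growth of the weights and terms
proportional to the drift speed p M / t. -/
theorem exists_majorant (h : IsRegularizedFlow f G A b α θ q p s c t₀ M xr lr x v l)
    (hc : 0 < c) (hp : 0 < p) (ht₀ : 0 < t₀) (hθ : 0 ≤ θ) {t δ K : ℝ} (hδ : 0 < δ) (hK : 0 < K)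
    (ht : t₀ < t) (hg : ∀ τ, t ≤ τ → 0 ≤ damping α θ q τ) :
    ∃ (F : ℝ → ℝ) (F' : ℝ), HasDerivAt F F' t ∧ F t = energy f A b α θ q p s c xr lr x v l t ∧
      (∀ᶠ τ in 𝓝[>] t, energy f A b α θ q p s c xr lr x v l τ ≤ F τ) ∧
      F' ≤ θ ^ 2 * ((2 * q + s) * t ^ (2 * q + s - 1)) *
          (regL f A b (c / t ^ p) (x t) (lr t) - regL f A b (c / t ^ p) (xr t) (lr t))
        + θ ^ 2 * t ^ (2 * q + s) * (c * p * t ^ (-p - 1) / 2 * M ^ 2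
          + p / t * M * (δ / 2 * ‖x t - xr t‖ ^ 2 + ‖A‖ ^ 2 / (2 * δ)))
        - damping α θ q t * θ * (t ^ q * ‖v t‖ ^ 2)
        - θ * t ^ (q + s) *
          (regL f A b (c / t ^ p) (x t) (lr t) - regL f A b (c / t ^ p) (xr t) (lr t)
            + c / t ^ p / 2 * ‖x t - xr t‖ ^ 2)
        - θ * (t ^ (q + s) * (c / t ^ p) * ‖l t - lr t‖ ^ 2)
        + 1 / 2 * (p / t * M) * (K * ‖x t - xr t + (θ * t ^ q) • v t‖ ^ 2 + 1 / K)
        + 1 / 2 * (θ * q * (1 - q) * t ^ (q - 2)) * ‖x t - xr t‖ ^ 2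
        + 1 / 2 * damping α θ q t * (p / t * M) * (K * ‖x t - xr t‖ ^ 2 + 1 / K)
        + θ / 2 * (p / t * M) * (K * ‖l t - lr t‖ ^ 2 + 1 / K) := by
  have h0 : 0 < t := ht₀.trans ht
  have htp : 0 < t ^ p := Real.rpow_pos_of_pos h0 _
  have htq : 0 < t ^ q := Real.rpow_pos_of_pos h0 _
  set e := c / t ^ p with he
  set n := G (x t) + A.adjoint (lr t) + e • x t with hn
  have kkt := h.kkt t ht.le
  have dP : HasDerivAt (fun τ : ℝ => τ ^ (2 * q + s)) ((2 * q + s) * t ^ (2 * q + s - 1)) t :=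
    Real.hasDerivAt_rpow_const (Or.inl h0.ne')
  have dD : HasDerivAt (fun τ => regL f A b e (x τ) (lr t) - regL f A b e (xr t) (lr t))
      ⟪n, v t⟫_ℝ t := by
    have h1 := (hasGradientAt_primal (h.grad (x t)) A b e (lr t)).hasFDerivAt
    exact (h1.comp_hasDerivAt t (h.deriv_x t ht)).sub_const _
  have dε : HasDerivAt (fun τ : ℝ => c / τ ^ p) (-(c * p * t ^ (-p - 1))) t := by
    have h1 := (Real.hasDerivAt_rpow_const (p := -p) (Or.inl h0.ne')).const_mul c
    refine (h1.congr_of_eventuallyEq ?_).congr_deriv (by ring)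
    filter_upwards [lt_mem_nhds h0] with τ hτ
    rw [Real.rpow_neg hτ.le, div_eq_mul_inv]
  have dρ : HasDerivAt (fun τ : ℝ => (τ ^ p / t ^ p - 1) * M) (p / t * M) t := by
    have h1 := (((Real.hasDerivAt_rpow_const (p := p) (Or.inl h0.ne')).div_const
      (t ^ p)).sub_const 1).mul_const M
    refine h1.congr_deriv ?_
    rw [Real.rpow_sub_one h0.ne']
    field_simp
  have dg : HasDerivAt (damping α θ q) (θ * q * (1 - q) * t ^ (q - 2)) t := by
    have h1 := ((Real.hasDerivAt_rpow_const (p := q - 1) (Or.inl h0.ne')).const_mul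
      (θ * q)).const_sub (α * θ - 1)
    refine h1.congr_deriv ?_
    rw [show q - 1 - 1 = q - 2 by ring]
    ring
  have dw := (h.deriv_x t ht).sub_const (xr t)
  have da := dw.norm_sq
  have dl := ((h.deriv_l t ht).sub_const (lr t)).norm_sq
  have du := (dw.add (((Real.hasDerivAt_rpow_const (p := q) (Or.inl h0.ne')).const_mul θ).smul
    (h.deriv_v t ht))).norm_sq
  -- The equation of motion removes the acceleration. The remaining coefficient of the velocity is 1
  -- + θ q t^(q-1) - α θ, the negative of the damping, which dictates the weight of ‖x - x_t‖² in
  -- the energy.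
  have eu : v t + ((θ * t ^ q) • (-((α / t ^ q) • v t)
      - t ^ s • (G (x t) + A.adjoint (l t) + (c / t ^ p) • x t))
      + (θ * (q * t ^ (q - 1))) • v t)
      = -(damping α θ q t • v t) - (θ * t ^ (q + s)) • (n + A.adjoint (l t - lr t)) := by
    have e1 : n + A.adjoint (l t - lr t) = G (x t) + A.adjoint (l t) + e • x t := by
      rw [hn, map_sub]; abel
    have e2 : θ * t ^ q * (α / t ^ q) = α * θ := by field_simp
    rw [e1, ← he, smul_sub, smul_neg, smul_smul, smul_smul, e2, Real.rpow_add h0, damping,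
      mul_assoc θ (t ^ q) (t ^ s)]
    module
  have el : t ^ (q + s) • (A (x t + (θ * t ^ q) • v t) - b - (c / t ^ p) • l t)
      = t ^ (q + s) • (A (x t - xr t + (θ * t ^ q) • v t) - e • (l t - lr t)) := by
    congr 1
    have : A (xr t) - b = e • lr t := kkt.2
    rw [smul_sub, ← this, map_add, map_add, map_sub]
    abel
  have hρ0 : (t ^ p / t ^ p - 1) * M = 0 := by rw [div_self htp.ne', sub_self, zero_mul]
  have hF := hasDerivAt_majorant (θ := θ) (M := M) (N := ‖A‖) (δ := δ) (K := K) (e := e)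
    dP dD dε dρ du dg da dl hρ0 rfl
  refine ⟨_, _, hF, ?_, ?_, ?_⟩
  · simp only [hρ0, ← he, Pi.add_apply, Pi.smul_apply', majorant, energy]
    ring
  · filter_upwards [self_mem_nhdsWithin] with τ hτ
    exact h.energy_le_majorant hc hp ht₀ hθ hδ hK ht.le (le_of_lt hτ) (hg τ (le_of_lt hτ))
  · have hdis := inner_dissipation A (x t - xr t) (v t) n (l t - lr t) θ (damping α θ q t)
      (t ^ q) (t ^ (q + s)) e
    -- Strong convexity turns ⟪n, x - x_t⟫ into dissipation of both the gap and ‖x - x_t‖².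
    have hgap : regL f A b e (x t) (lr t) - regL f A b e (xr t) (lr t)
        + e / 2 * ‖x t - xr t‖ ^ 2 ≤ ⟪n, x t - xr t⟫_ℝ := by
      have h1 := strong_convexity_gap h.convex (h.grad (x t)) A b e (lr t) (xr t)
      rw [← hn, ← neg_sub (x t) (xr t), inner_neg_right, norm_neg] at h1
      simp only [regL]
      linarith
    have hgap2 := mul_le_mul_of_nonneg_left hgap
      (mul_nonneg hθ (Real.rpow_pos_of_pos h0 (q + s)).le)
    have hP : t ^ (2 * q + s) = t ^ q * t ^ (q + s) := by
      rw [← Real.rpow_add h0]; ring_nf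
    simp only [Pi.add_apply, Pi.smul_apply']
    rw [eu, el]
    rw [← hP] at hdis
    linarith

end IsRegularizedFlow

/-! ### Absorption of the drift into the dissipation -/

theorem eventually_mul_le_nhdsGT_zero (k : ℝ) {u : ℝ} (hu : 0 < u) :
    ∀ᶠ δ : ℝ in 𝓝[>] 0, k * δ ≤ u := by
  have h : Tendsto (fun δ : ℝ => k * δ) (𝓝[>] 0) (𝓝 0) := by
    have : Tendsto (fun δ : ℝ => k * δ) (𝓝 0) (𝓝 (k * 0)) := by
      exact (continuous_const.mul continuous_id).tendsto 0
    rw [mul_zero] at this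
    exact this.mono_left nhdsWithin_le_nhds
  filter_upwards [h.eventually_lt_const hu] with δ hδ using hδ.le

/-- `P`, `Q`, `R`, `S` are the dissipated gap, primal distance, velocity and dual distance. Each
dissipation coefficient is split between the drift (`δ`), the decay rate (`κ`) and, for `P` and `Q`,
terms that are small for large t. The hypothesis p ≤ 1 - q makes t^(2q+s-1) at most t^(q+s-p), so
the drift error in the gap fits under `Q`. -/
theorem absorb_at_time {α θ q p s c M N r m δ κ t : ℝ} (hθ : 0 < θ)
    (hc : 0 < c) (hp : 0 < p) (hM : 0 ≤ M) (hq0 : 0 ≤ q) (hpq : p ≤ 1 - q)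
    (hrq : q ≤ r) (hrp : p - q - s ≤ r) (hm1 : 2 * q + s - 1 ≤ m) (hm2 : r - 2 ≤ m) (hδ : 0 < δ)
    (hκ : 0 < κ) (h1 : p * M * (θ ^ 2 / 2 + 1 + (α * θ - 1) / 2) * δ ≤ θ * c / 8)
    (h2 : p * M * θ ^ 2 * δ ≤ (α * θ - 1) / 2 * θ / 2) (h3 : p * M * δ ≤ c)
    (k1 : θ ^ 2 * κ ≤ θ / 2) (k2 : (1 + (α * θ - 1) / 2) * κ ≤ θ * c / 4)
    (k3 : θ ^ 2 * κ ≤ (α * θ - 1) / 2 * θ / 2) (k4 : 1 * κ ≤ c)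
    (ht : 1 ≤ t) (t1 : θ ^ 2 * (2 * q + s) * t ^ (q - 1) ≤ θ / 2)
    (t2 : θ * q * t ^ (q - 1) ≤ (α * θ - 1) / 2)
    (t3 : 1 / 2 * (θ * q * (1 - q)) * t ^ (p - s - 2) ≤ θ * c / 8)
    {D a V w U : ℝ} (hD : 0 ≤ D) (ha : 0 ≤ a) (hV : 0 ≤ V) (hw : 0 ≤ w)
    (hUle : U ≤ 2 * a + 2 * ((θ * t ^ q) ^ 2 * V)) :
    θ ^ 2 * ((2 * q + s) * t ^ (2 * q + s - 1)) * D
        + θ ^ 2 * t ^ (2 * q + s) * (c * p * t ^ (-p - 1) / 2 * M ^ 2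
          + p / t * M * (δ / 2 * a + N ^ 2 / (2 * δ)))
        - damping α θ q t * θ * (t ^ q * V)
        - θ * t ^ (q + s) * (D + c / t ^ p / 2 * a)
        - θ * (t ^ (q + s) * (c / t ^ p) * w)
        + 1 / 2 * (p / t * M) * (δ * t ^ (1 - r) * U + 1 / (δ * t ^ (1 - r)))
        + 1 / 2 * (θ * q * (1 - q) * t ^ (q - 2)) * a
        + 1 / 2 * damping α θ q t * (p / t * M) * (δ * t ^ (1 - r) * a + 1 / (δ * t ^ (1 - r)))
        + θ / 2 * (p / t * M) * (δ * t ^ (1 - r) * w + 1 / (δ * t ^ (1 - r)))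
      ≤ -κ * (t ^ (-r) * (θ ^ 2 * t ^ (2 * q + s) * D + 1 / 2 * U + 1 / 2 * damping α θ q t * a
          + θ / 2 * w))
        + (θ ^ 2 * (c * p * M ^ 2 / 2 + p * M * (N ^ 2 / (2 * δ)))
          + (p * M) / δ * (1 / 2 + (α * θ - 1) / 2 + θ / 2)) * t ^ m := by
  have h0 : 0 < t := by linarith
  have tpos : ∀ k : ℝ, 0 < t ^ k := fun k => Real.rpow_pos_of_pos h0 k
  have tle : ∀ {j k : ℝ}, j ≤ k → t ^ j ≤ t ^ k := fun h => Real.rpow_le_rpow_of_exponent_le ht h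
  have tadd : ∀ j k : ℝ, t ^ (j + k) = t ^ j * t ^ k := fun j k => Real.rpow_add h0 j k
  set g₀ := (α * θ - 1) / 2 with hg₀
  have hg0 : 0 ≤ g₀ := by
    have := mul_nonneg (mul_nonneg hp.le hM) (sq_nonneg θ)
    have := mul_nonneg this hδ.le
    by_contra hneg
    push Not at hneg
    nlinarith
  have hgl : g₀ ≤ damping α θ q t := by
    rw [damping]; linarith
  have hgu : damping α θ q t ≤ 2 * g₀ := by
    have : 0 ≤ θ * q * t ^ (q - 1) := mul_nonneg (mul_nonneg hθ.le hq0) (tpos _).le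
    rw [damping]; linarith
  set W := p * M with hW
  have hW0 : 0 ≤ W := mul_nonneg hp.le hM
  set Z := t ^ m
  set P := t ^ (q + s) * D with hP
  set Q := t ^ (q + s - p) * a with hQ
  set R := t ^ q * V with hR
  set S := t ^ (q + s - p) * w with hS
  have hP0 : 0 ≤ P := mul_nonneg (tpos _).le hD
  have hQ0 : 0 ≤ Q := mul_nonneg (tpos _).le ha
  have hR0 : 0 ≤ R := mul_nonneg (tpos _).le hV
  have hS0 : 0 ≤ S := mul_nonneg (tpos _).le hw
  have epp : t ^ (q + s) * (c / t ^ p) = c * t ^ (q + s - p) := by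
    rw [Real.rpow_sub h0]; ring
  have F1 : θ ^ 2 * ((2 * q + s) * t ^ (2 * q + s - 1)) * D ≤ θ / 2 * P := by
    have e : t ^ (2 * q + s - 1) = t ^ (q - 1) * t ^ (q + s) := by rw [← tadd]; ring_nf
    have := mul_le_mul_of_nonneg_right t1 hP0
    rw [e]; linarith
  have F2 : t ^ (2 * q + s) * (c * p * t ^ (-p - 1) / 2 * M ^ 2) ≤ c * p * M ^ 2 / 2 * Z := by
    have e : t ^ (2 * q + s) * (c * p * t ^ (-p - 1) / 2 * M ^ 2)
        = c * p * M ^ 2 / 2 * t ^ (2 * q + s + (-p - 1)) := by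
      rw [tadd (2 * q + s)]; ring
    rw [e]
    exact mul_le_mul_of_nonneg_left (tle (by linarith)) (by positivity)
  have F3 : t ^ (2 * q + s) * (p / t * M * (δ / 2 * a + N ^ 2 / (2 * δ)))
      ≤ W * (δ / 2) * Q + W * (N ^ 2 / (2 * δ)) * Z := by
    have e : t ^ (2 * q + s) * (p / t * M * (δ / 2 * a + N ^ 2 / (2 * δ)))
        = W * (δ / 2) * (t ^ (2 * q + s - 1) * a)
          + W * (N ^ 2 / (2 * δ)) * t ^ (2 * q + s - 1) := by
      rw [Real.rpow_sub_one h0.ne']; ring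
    rw [e]
    refine add_le_add ?_ ?_
    · exact mul_le_mul_of_nonneg_left (mul_le_mul_of_nonneg_right (tle (by linarith)) ha)
        (by positivity)
    · exact mul_le_mul_of_nonneg_left (tle hm1) (by positivity)
  have F4 : g₀ * θ * R ≤ damping α θ q t * θ * R := by gcongr
  have F5 : θ * t ^ (q + s) * (D + c / t ^ p / 2 * a) = θ * P + θ * c / 2 * Q := by
    have : θ * t ^ (q + s) * (D + c / t ^ p / 2 * a)
      = θ * P + θ / 2 * (t ^ (q + s) * (c / t ^ p)) * a := by ring
    rw [this, epp]; ring
  have F6 : θ * (t ^ (q + s) * (c / t ^ p) * w) = θ * c * S := by rw [epp]; ring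
  have ra : t ^ (-r) * a ≤ Q := mul_le_mul_of_nonneg_right (tle (by linarith)) ha
  have rw' : t ^ (-r) * w ≤ S := mul_le_mul_of_nonneg_right (tle (by linarith)) hw
  have rU : t ^ (-r) * U ≤ 2 * Q + 2 * θ ^ 2 * R := by
    have e : t ^ (-r) * (t ^ q) ^ 2 = t ^ (-r + (q + q)) := by rw [tadd, tadd]; ring
    have e2 : t ^ (-r + (q + q)) * V ≤ R := mul_le_mul_of_nonneg_right (tle (by linarith)) hV
    have e3 := mul_le_mul_of_nonneg_left hUle (tpos (-r)).le
    rw [← e] at e2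
    have e4 := mul_le_mul_of_nonneg_left e2 (sq_nonneg θ)
    linarith
  have rD : t ^ (-r) * (t ^ (2 * q + s) * D) ≤ P := by
    rw [← mul_assoc, ← tadd]
    exact mul_le_mul_of_nonneg_right (tle (by linarith)) hD
  -- Effect of the Young parameter δ t^(1-r): multiplied by the drift speed of order 1/t, it gives δ
  -- t^(-r), matching the decay rate, while its inverse gives the source t^(r-2)/δ.
  have eK : ∀ y B : ℝ, t ^ (-r) * y ≤ B →
      p / t * M * (δ * t ^ (1 - r) * y + 1 / (δ * t ^ (1 - r))) ≤ W * (δ * B + Z / δ) := by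
    intro y B hB
    have e1 : t ^ (1 - r) = t * t ^ (-r) := by
      rw [sub_eq_add_neg, tadd, Real.rpow_one]
    have e2 : t ^ (r - 2) = 1 / (t * t ^ (1 - r)) := by
      rw [eq_div_iff (mul_pos h0 (tpos _)).ne', e1, ← mul_assoc, mul_comm, ← mul_assoc]
      have : t ^ (-r) * t ^ (r - 2) * t * t = t ^ (-r + (r - 2) + 1 + 1) := by
        rw [tadd _ 1, tadd _ 1, tadd, Real.rpow_one]
      have e0 : -r + (r - 2) + 1 + 1 = 0 := by ring
      rw [e0, Real.rpow_zero] at this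
      linarith
    have e3 : p / t * M * (δ * t ^ (1 - r) * y + 1 / (δ * t ^ (1 - r)))
        = W * (δ * (t ^ (-r) * y) + t ^ (r - 2) / δ) := by
      rw [e2, e1]
      have := (tpos (-r)).ne'
      field_simp
      rw [hW]
      ring
    rw [e3]
    have := tle hm2
    gcongr
  have F7 := eK U _ rU
  have F9 := eK a _ ra
  have F10 := eK w _ rw'
  have F9' : damping α θ q t * (p / t * M * (δ * t ^ (1 - r) * a + 1 / (δ * t ^ (1 - r))))
      ≤ 2 * g₀ * (W * (δ * Q + Z / δ)) := by
    refine mul_le_mul hgu F9 ?_ (by positivity)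
    have := tpos (1 - r)
    positivity
  have F8 : 1 / 2 * (θ * q * (1 - q) * t ^ (q - 2)) * a ≤ θ * c / 8 * Q := by
    have e : t ^ (q - 2) = t ^ (p - s - 2) * t ^ (q + s - p) := by rw [← tadd]; ring_nf
    have := mul_le_mul_of_nonneg_right t3 hQ0
    rw [e]; linarith
  have F10' := mul_le_mul_of_nonneg_left F10 (show 0 ≤ θ / 2 by positivity)
  have F2' := mul_le_mul_of_nonneg_left (add_le_add F2 F3) (sq_nonneg θ)
  have E1 : t ^ (-r) * (θ ^ 2 * t ^ (2 * q + s) * D + 1 / 2 * U + 1 / 2 * damping α θ q t * a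
      + θ / 2 * w) ≤ θ ^ 2 * P + (Q + θ ^ 2 * R) + g₀ * Q + θ / 2 * S := by
    have e1 := mul_le_mul_of_nonneg_left rD (sq_nonneg θ)
    have e2 := mul_le_mul hgu ra (mul_nonneg (tpos _).le ha) (by positivity)
    have e3 := mul_le_mul_of_nonneg_left rw' (show 0 ≤ θ / 2 by positivity)
    linarith
  have E2 := mul_le_mul_of_nonneg_left E1 hκ.le
  have G1 := mul_le_mul_of_nonneg_right h1 hQ0
  have G2 := mul_le_mul_of_nonneg_right h2 hR0
  have G3 := mul_le_mul_of_nonneg_right h3 (mul_nonneg hθ.le hS0)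
  have K1 := mul_le_mul_of_nonneg_right k1 hP0
  have K2 := mul_le_mul_of_nonneg_right k2 hQ0
  have K3 := mul_le_mul_of_nonneg_right k3 hR0
  have K4 := mul_le_mul_of_nonneg_right k4 (mul_nonneg hθ.le hS0)
  have ez : Z / δ = δ⁻¹ * Z := by ring
  have ew : W / δ = W * δ⁻¹ := by ring
  rw [ez] at F7 F9' F10'
  rw [ew]
  linarith

theorem exists_absorption {α θ q p s c M N r m : ℝ} (hαθ : 1 < α * θ) (hθ : 0 < θ)
    (hc : 0 < c) (hp : 0 < p) (hM : 0 ≤ M) (hq0 : 0 ≤ q) (hq1 : q < 1) (hpq : p ≤ 1 - q)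
    (hs : p - q - 1 < s)
    (hrq : q ≤ r) (hrp : p - q - s ≤ r) (hm1 : 2 * q + s - 1 ≤ m) (hm2 : r - 2 ≤ m) :
    ∃ δ > 0, ∃ κ > 0, ∃ C, ∀ᶠ t : ℝ in atTop, 1 ≤ t ∧ (α * θ - 1) / 2 ≤ damping α θ q t ∧
    ∀ {D a V w U : ℝ}, 0 ≤ D → 0 ≤ a → 0 ≤ V → 0 ≤ w →
    U ≤ 2 * a + 2 * ((θ * t ^ q) ^ 2 * V) →
    θ ^ 2 * ((2 * q + s) * t ^ (2 * q + s - 1)) * D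
        + θ ^ 2 * t ^ (2 * q + s) * (c * p * t ^ (-p - 1) / 2 * M ^ 2
          + p / t * M * (δ / 2 * a + N ^ 2 / (2 * δ)))
        - damping α θ q t * θ * (t ^ q * V)
        - θ * t ^ (q + s) * (D + c / t ^ p / 2 * a)
        - θ * (t ^ (q + s) * (c / t ^ p) * w)
        + 1 / 2 * (p / t * M) * (δ * t ^ (1 - r) * U + 1 / (δ * t ^ (1 - r)))
        + 1 / 2 * (θ * q * (1 - q) * t ^ (q - 2)) * a
        + 1 / 2 * damping α θ q t * (p / t * M) * (δ * t ^ (1 - r) * a + 1 / (δ * t ^ (1 - r)))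
        + θ / 2 * (p / t * M) * (δ * t ^ (1 - r) * w + 1 / (δ * t ^ (1 - r)))
      ≤ -κ * (t ^ (-r) * (θ ^ 2 * t ^ (2 * q + s) * D + 1 / 2 * U + 1 / 2 * damping α θ q t * a
          + θ / 2 * w)) + C * t ^ m := by
  have hg0 : 0 < (α * θ - 1) / 2 := by linarith
  obtain ⟨δ, ⟨⟨h1, h2⟩, h3⟩, hδ⟩ := (((eventually_mul_le_nhdsGT_zero
    (p * M * (θ ^ 2 / 2 + 1 + (α * θ - 1) / 2)) (show 0 < θ * c / 8 by positivity)).and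
    (eventually_mul_le_nhdsGT_zero (p * M * θ ^ 2)
      (show 0 < (α * θ - 1) / 2 * θ / 2 by positivity))).and
    (eventually_mul_le_nhdsGT_zero (p * M) hc)).and self_mem_nhdsWithin |>.exists
  obtain ⟨κ, ⟨⟨⟨k1, k2⟩, k3⟩, k4⟩, hκ⟩ := ((((eventually_mul_le_nhdsGT_zero (θ ^ 2)
    (show 0 < θ / 2 by positivity)).and
    (eventually_mul_le_nhdsGT_zero (1 + (α * θ - 1) / 2)
      (show 0 < θ * c / 4 by positivity))).and
    (eventually_mul_le_nhdsGT_zero (θ ^ 2)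
      (show 0 < (α * θ - 1) / 2 * θ / 2 by positivity))).and
    (eventually_mul_le_nhdsGT_zero 1 hc)).and self_mem_nhdsWithin |>.exists
  refine ⟨δ, hδ, κ, hκ, θ ^ 2 * (c * p * M ^ 2 / 2 + p * M * (N ^ 2 / (2 * δ)))
    + (p * M) / δ * (1 / 2 + (α * θ - 1) / 2 + θ / 2), ?_⟩
  filter_upwards [eventually_ge_atTop 1,
    eventually_mul_rpow_le (sub_neg.2 hq1) (θ ^ 2 * (2 * q + s)) (show 0 < θ / 2 by positivity),
    eventually_mul_rpow_le (sub_neg.2 hq1) (θ * q) hg0,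
    eventually_mul_rpow_le (show p - s - 2 < 0 by linarith) (1 / 2 * (θ * q * (1 - q)))
      (show 0 < θ * c / 8 by positivity)] with t ht t1 t2 t3
  refine ⟨ht, by rw [damping]; linarith, fun hD ha hV hw hUle => ?_⟩
  exact absorb_at_time hθ hc hp hM hq0 hpq hrq hrp hm1 hm2 hδ hκ h1 h2 h3 k1 k2 k3 k4 ht t1 t2 t3
    hD ha hV hw hUle

/-! ### Decay of the energy -/

namespace IsRegularizedFlow

variable {f : X → ℝ} {G : X → X} {A : X →L[ℝ] Y} {b : Y} {α θ q p s c t₀ M : ℝ}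
  {xr : ℝ → X} {lr : ℝ → Y} {x v : ℝ → X} {l : ℝ → Y}

theorem continuousOn_energy (h : IsRegularizedFlow f G A b α θ q p s c t₀ M xr lr x v l)
    (hc : 0 < c) (hp : 0 < p) (ht₀ : 0 < t₀) :
    ContinuousOn (energy f A b α θ q p s c xr lr x v l) (Ioi t₀) := by
  have hf : Continuous f := continuous_iff_continuousAt.2 fun y => (h.grad y).continuousAt
  have hx : ContinuousOn x (Ioi t₀) := fun t ht =>
    (h.deriv_x t ht).continuousAt.continuousWithinAt
  have hv : ContinuousOn v (Ioi t₀) := fun t ht =>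
    (h.deriv_v t ht).continuousAt.continuousWithinAt
  have hl : ContinuousOn l (Ioi t₀) := fun t ht =>
    (h.deriv_l t ht).continuousAt.continuousWithinAt
  have hxr := (h.continuousOn_xr hc hp ht₀).mono Ioi_subset_Ici_self
  have hlr := (h.continuousOn_lr hc hp ht₀).mono Ioi_subset_Ici_self
  have hpow : ∀ k : ℝ, ContinuousOn (fun t : ℝ => t ^ k) (Ioi t₀) := fun k t ht =>
    (Real.continuousAt_rpow_const _ _ (Or.inl (ht₀.trans ht).ne')).continuousWithinAt
  have he : ContinuousOn (fun t : ℝ => c / t ^ p) (Ioi t₀) :=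
    continuousOn_const.div (hpow p) fun t ht => (Real.rpow_pos_of_pos (ht₀.trans ht) _).ne'
  have h1 := hpow (2 * q + s)
  have h2 := hpow q
  have h3 := hpow (q - 1)
  have h4 := hf.comp_continuousOn hx
  have h5 := hf.comp_continuousOn hxr
  simp only [Function.comp_def] at h4 h5
  unfold energy damping regL
  fun_prop

theorem regL_gap_nonneg (h : IsRegularizedFlow f G A b α θ q p s c t₀ M xr lr x v l)
    (hc : 0 < c) (ht₀ : 0 < t₀) {t : ℝ} (ht : t₀ ≤ t) (y : X) :
    0 ≤ regL f A b (c / t ^ p) y (lr t) - regL f A b (c / t ^ p) (xr t) (lr t) := by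
  have h1 := (h.kkt t ht).regL_le h.convex h.grad y
  have : 0 < t ^ p := Real.rpow_pos_of_pos (ht₀.trans_le ht) _
  have : 0 ≤ c / t ^ p / 2 * ‖y - xr t‖ ^ 2 := by positivity
  linarith

theorem norm_add_sq_le_two_mul (w u : X) : ‖w + u‖ ^ 2 ≤ 2 * ‖w‖ ^ 2 + 2 * ‖u‖ ^ 2 := by
  have h1 := norm_add_sq_real w u
  have h2 := norm_sub_sq_real w u
  have := sq_nonneg ‖w - u‖
  linarith

theorem energy_isBigO (h : IsRegularizedFlow f G A b α θ q p s c t₀ M xr lr x v l)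
    (hαθ : 1 < α * θ) (hθ : 0 < θ) (hc : 0 < c) (hp : 0 < p) (ht₀ : 0 < t₀) (hq0 : 0 ≤ q)
    (hq1 : q < 1) (hpq : p ≤ 1 - q) (hs : p - q - 1 < s) {r m : ℝ} (hr : r < 1)
    (hrq : q ≤ r) (hrp : p - q - s ≤ r) (hm1 : 2 * q + s - 1 ≤ m) (hm2 : r - 2 ≤ m) :
    ∃ K, ∀ᶠ t in atTop, energy f A b α θ q p s c xr lr x v l t ≤ K * t ^ (m + r) := by
  have hM : 0 ≤ M := (norm_nonneg _).trans (h.norm_xr_le le_rfl)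
  obtain ⟨δ, hδ, κ, hκ, C, hev⟩ := exists_absorption (N := ‖A‖) hαθ hθ hc hp hM hq0 hq1 hpq hs hrq
    hrp hm1 hm2
  obtain ⟨T, hT⟩ := eventually_atTop.1 (hev.and (eventually_gt_atTop t₀))
  have hTt : ∀ t, T ≤ t → t₀ < t := fun t ht => (hT t ht).2
  refine exists_le_mul_rpow_of_dissipative_majorant (T := T) (C := C) hκ hr
    ((h.continuousOn_energy hc hp ht₀).mono fun t ht => hTt t ht) fun t ht => ?_
  obtain ⟨⟨ht1, hgt, habs⟩, htt⟩ := hT t ht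
  have h0 : 0 < t := ht₀.trans htt
  -- The Young parameter may depend on the frozen time t, since it stays constant in the variable of
  -- the majorant.
  have hK : 0 < δ * t ^ (1 - r) := mul_pos hδ (Real.rpow_pos_of_pos h0 _)
  obtain ⟨F, F', hF, hFt, hle, hF'⟩ := h.exists_majorant hc hp ht₀ hθ.le hδ hK htt
    fun τ hτ => le_trans (by linarith) (hT τ (ht.trans hτ)).1.2.1
  refine ⟨F, F', hF, hFt, hle, hF'.trans ?_⟩
  refine (habs (h.regL_gap_nonneg hc ht₀ htt.le (x t)) (sq_nonneg _) (sq_nonneg _) (sq_nonneg _)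
    ?_).trans (le_of_eq ?_)
  · have := norm_add_sq_le_two_mul (x t - xr t) ((θ * t ^ q) • v t)
    rwa [norm_smul, mul_pow, Real.norm_eq_abs, sq_abs] at this
  · rw [energy]

/-- The decay estimates contained in the energy estimate. -/
theorem exists_decay_bounds (h : IsRegularizedFlow f G A b α θ q p s c t₀ M xr lr x v l)
    (hαθ : 1 < α * θ) (hθ : 0 < θ) (hc : 0 < c) (hp : 0 < p) (ht₀ : 0 < t₀) (hq0 : 0 ≤ q)
    (hq1 : q < 1) (hpq : p ≤ 1 - q) (hs : p - q - 1 < s) {r m : ℝ} (hr : r < 1)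
    (hrq : q ≤ r) (hrp : p - q - s ≤ r) (hm1 : 2 * q + s - 1 ≤ m) (hm2 : r - 2 ≤ m) :
    ∃ K, 0 ≤ K ∧ ∀ᶠ t in atTop,
      regL f A b (c / t ^ p) (x t) (lr t) - regL f A b (c / t ^ p) (xr t) (lr t)
        ≤ K * t ^ (m + r - 2 * q - s) ∧
      ‖x t - xr t‖ ^ 2 ≤ K * t ^ (m + r) ∧ ‖l t - lr t‖ ^ 2 ≤ K * t ^ (m + r) ∧
      ‖v t‖ ^ 2 ≤ K * t ^ (m + r - 2 * q) := by
  have hM : 0 ≤ M := (norm_nonneg _).trans (h.norm_xr_le le_rfl)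
  obtain ⟨K, hK⟩ := h.energy_isBigO hαθ hθ hc hp ht₀ hq0 hq1 hpq hs hr hrq hrp hm1 hm2
  have hg0 : 0 < (α * θ - 1) / 2 := by linarith
  obtain ⟨δ, hδ, κ, hκ, C, hev⟩ := exists_absorption (N := ‖A‖) hαθ hθ hc hp hM hq0 hq1 hpq hs hrq
    hrp hm1 hm2
  set g₀ := (α * θ - 1) / 2
  set L := |K| / θ ^ 2 + 2 * |K| / g₀ + 2 * |K| / θ + (4 * |K| + 2 * (2 * |K| / g₀)) / θ ^ 2
    with hL
  have n1 : 0 ≤ |K| / θ ^ 2 := by positivity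
  have n2 : 0 ≤ 2 * |K| / g₀ := by positivity
  have n3 : 0 ≤ 2 * |K| / θ := by positivity
  have n4 : 0 ≤ (4 * |K| + 2 * (2 * |K| / g₀)) / θ ^ 2 := by positivity
  refine ⟨L, by positivity, ?_⟩
  filter_upwards [hK, hev, eventually_gt_atTop t₀] with t hE hd htt
  have h0 : 0 < t := ht₀.trans htt
  have hz : 0 < t ^ (m + r) := Real.rpow_pos_of_pos h0 _
  set Z := t ^ (m + r) with hZ
  have hE : energy f A b α θ q p s c xr lr x v l t ≤ |K| * Z :=
    hE.trans (mul_le_mul_of_nonneg_right (le_abs_self K) hz.le)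
  rw [energy] at hE
  have hD := h.regL_gap_nonneg hc ht₀ htt.le (x t)
  set D := regL f A b (c / t ^ p) (x t) (lr t) - regL f A b (c / t ^ p) (xr t) (lr t)
  have htq : 0 < t ^ (2 * q + s) := Real.rpow_pos_of_pos h0 _
  have p1 : 0 ≤ θ ^ 2 * t ^ (2 * q + s) * D := by positivity
  have p2 : 0 ≤ ‖x t - xr t + (θ * t ^ q) • v t‖ ^ 2 := sq_nonneg _
  have p3 : g₀ * ‖x t - xr t‖ ^ 2 ≤ damping α θ q t * ‖x t - xr t‖ ^ 2 :=
    mul_le_mul_of_nonneg_right hd.2.1 (sq_nonneg _)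
  have p3' : 0 ≤ g₀ * ‖x t - xr t‖ ^ 2 := by positivity
  have p4 : 0 ≤ θ / 2 * ‖l t - lr t‖ ^ 2 := by positivity
  have hx : ‖x t - xr t‖ ^ 2 ≤ 2 * |K| / g₀ * Z := by
    rw [div_mul_eq_mul_div, le_div_iff₀ hg0]
    linarith
  have mono : ∀ {k : ℝ}, k ≤ L → k * Z ≤ L * Z := fun hk => mul_le_mul_of_nonneg_right hk hz.le
  refine ⟨?_, hx.trans (mono (by linarith)), le_trans ?_ (mono (show 2 * |K| / θ ≤ L by linarith)),
    ?_⟩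
  · have e : t ^ (m + r - 2 * q - s) = Z / t ^ (2 * q + s) := by
      rw [hZ, ← Real.rpow_sub h0]; ring_nf
    rw [e, mul_div_assoc', le_div_iff₀ htq]
    refine le_trans ?_ (mono (show |K| / θ ^ 2 ≤ L by linarith))
    rw [div_mul_eq_mul_div, le_div_iff₀ (by positivity)]
    linarith
  · rw [div_mul_eq_mul_div, le_div_iff₀ hθ]
    linarith
  · have htq2 : 0 < t ^ (2 * q) := Real.rpow_pos_of_pos h0 _
    have e : t ^ (m + r - 2 * q) = Z / t ^ (2 * q) := by
      rw [hZ, ← Real.rpow_sub h0]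
    rw [e, mul_div_assoc', le_div_iff₀ htq2]
    refine le_trans ?_ (mono (show (4 * |K| + 2 * (2 * |K| / g₀)) / θ ^ 2 ≤ L by linarith))
    rw [div_mul_eq_mul_div, le_div_iff₀ (by positivity)]
    -- The velocity is recovered as the difference of (x - x_t) + θ t^q v and x - x_t, both
    -- controlled by the energy.
    have h1 := norm_add_sq_le_two_mul (x t - xr t + (θ * t ^ q) • v t) (-(x t - xr t))
    rw [add_neg_cancel_comm, norm_smul, norm_neg, mul_pow, Real.norm_eq_abs, sq_abs, mul_pow,
      ← Real.rpow_natCast (t ^ q), ← Real.rpow_mul h0.le,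
      show q * ((2 : ℕ) : ℝ) = 2 * q by push_cast; ring] at h1
    linarith

end IsRegularizedFlow

/-! ### From the energy estimate to the stated rates -/

theorem isBigO_one_div_rpow {u : ℝ → ℝ} {K k : ℝ}
    (h : ∀ᶠ t : ℝ in atTop, 0 ≤ u t ∧ u t ≤ K * t ^ (-k)) :
    u =O[atTop] fun t : ℝ => 1 / t ^ k := by
  refine IsBigO.of_bound K ?_
  filter_upwards [h, eventually_gt_atTop 0] with t ht h0
  have : 0 < t ^ k := Real.rpow_pos_of_pos h0 _
  rw [Real.norm_of_nonneg ht.1, Real.norm_of_nonneg (by positivity), one_div,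
    ← Real.rpow_neg h0.le]
  exact ht.2

theorem isBigO_one_div_rpow_add {u : ℝ → ℝ} {K p k : ℝ}
    (h : ∀ᶠ t : ℝ in atTop, 0 ≤ u t ∧ u t ≤ K * (t ^ (-p) + t ^ (-k))) :
    u =O[atTop] fun t : ℝ => 1 / t ^ p + 1 / t ^ k := by
  refine IsBigO.of_bound K ?_
  filter_upwards [h, eventually_gt_atTop 0] with t ht h0
  have : 0 < t ^ k := Real.rpow_pos_of_pos h0 _
  have : 0 < t ^ p := Real.rpow_pos_of_pos h0 _
  rw [Real.norm_of_nonneg ht.1, Real.norm_of_nonneg (by positivity), one_div, one_div,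
    ← Real.rpow_neg h0.le, ← Real.rpow_neg h0.le]
  exact ht.2

theorem regLagrangian_eq_regL (f : X → ℝ) (A : X →L[ℝ] Y) (b : Y) (c p t : ℝ) (x : X) (l : Y) :
    regLagrangian f A b c p t x l = regL f A b (c / t ^ p) x l := by
  rw [regLagrangian, lagrangian, regL]
  congr 2
  rw [div_div, mul_comm]

theorem lagrangian_eq_regL (f : X → ℝ) (A : X →L[ℝ] Y) (b : Y) (x : X) (l : Y) :
    lagrangian f A b x l = regL f A b 0 x l := by
  rw [lagrangian, regL]; ring

theorem mem_saddleSet_regLagrangian_iff {f : X → ℝ} (hconv : ConvexOn ℝ univ f) {G : X → X}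
    (hG : ∀ x, HasGradientAt f (G x) x) (A : X →L[ℝ] Y) (b : Y) {c p t : ℝ} (h : 0 ≤ c / t ^ p)
    (z : X × Y) : z ∈ saddleSet (regLagrangian f A b c p t) ↔ IsKKT G A b (c / t ^ p) z := by
  rw [← mem_saddleSet_iff_isKKT hconv hG A b h,
    show regLagrangian f A b c p t = regL f A b (c / t ^ p) from
      funext₂ (regLagrangian_eq_regL f A b c p t)]
  rfl

theorem mem_saddleSet_lagrangian_iff {f : X → ℝ} (hconv : ConvexOn ℝ univ f) {G : X → X}
    (hG : ∀ x, HasGradientAt f (G x) x) (A : X →L[ℝ] Y) (b : Y)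
    (z : X × Y) : z ∈ saddleSet (lagrangian f A b) ↔ IsKKT G A b 0 z := by
  rw [← mem_saddleSet_iff_isKKT hconv hG A b le_rfl,
    show lagrangian f A b = regL f A b 0 from funext₂ (lagrangian_eq_regL f A b)]
  rfl

/-- The Pythagorean inequality leaves no room for a second element of minimal norm, so convexity of
the solution set is not needed. -/
theorem eq_of_isMinNormElement {S : Set (X × Y)} {w z : X × Y} (hw : w ∈ S)
    (h : ∀ v ∈ S, pairNorm w ^ 2 + pairNorm (v - w) ^ 2 ≤ pairNorm v ^ 2)
    (hz : IsMinNormElement S z) : z = w := by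
  have h1 := h z hz.1
  have h2 : pairNorm z ^ 2 ≤ pairNorm w ^ 2 := by
    have : 0 ≤ pairNorm z := norm_nonneg _
    gcongr
    exact hz.2 w hw
  have h3 : pairNorm (z - w) = 0 := by
    have h4 : pairNorm (z - w) ^ 2 ≤ 0 := by linarith
    exact pow_eq_zero_iff two_ne_zero |>.1 (le_antisymm h4 (sq_nonneg _))
  have h4 := (norm_fst_le_pairNorm (z - w)).trans h3.le
  have h5 := (norm_snd_le_pairNorm (z - w)).trans h3.le
  rw [norm_le_zero_iff] at h4 h5
  exact sub_eq_zero.1 (Prod.ext h4 h5)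

theorem isMinNormElement_of_sq {S : Set (X × Y)} {w : X × Y} (hw : w ∈ S)
    (h : ∀ v ∈ S, pairNorm w ^ 2 + pairNorm (v - w) ^ 2 ≤ pairNorm v ^ 2) :
    IsMinNormElement S w :=
  ⟨hw, fun v hv => le_of_sq_le_sq (by nlinarith [h v hv, sq_nonneg (pairNorm (v - w))])
    (norm_nonneg _)⟩

theorem tendsto_div_rpow_atTop {c p : ℝ} (hp : 0 < p) :
    Tendsto (fun t : ℝ => c / t ^ p) atTop (𝓝 0) :=
  (tendsto_rpow_atTop hp).const_div_atTop c

theorem hasDerivAt_velocity {t₀ : ℝ} {y : ℝ → X} (hy : DifferentiableOn ℝ y (Ici t₀)) {t : ℝ}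
    (ht : t₀ < t) : HasDerivAt y (velocity t₀ y t) t :=
  ((hy t ht.le).hasDerivWithinAt).hasDerivAt (Ici_mem_nhds ht)

/-- Derivatives within [t₀, ∞) are two-sided for t > t₀, and the gradients in the system are the
regularized ones at parameter 0. -/
theorem IsTrajectory.isRegularizedFlow {f : X → ℝ} {G : X → X} {A : X →L[ℝ] Y} {b : Y}
    {α θ q p s c t₀ M : ℝ} {xr : ℝ → X} {lr : ℝ → Y} {x : ℝ → X} {l : ℝ → Y}
    (h : IsTrajectory f A b α θ q p s c t₀ x l) (hconv : ConvexOn ℝ univ f)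
    (hG : ∀ x, HasGradientAt f (G x) x)
    (hkkt : ∀ t, t₀ ≤ t → IsKKT G A b (c / t ^ p) (xr t, lr t))
    (hM : ∀ t, t₀ ≤ t → pairNorm (xr t, lr t) ≤ M) :
    IsRegularizedFlow f G A b α θ q p s c t₀ M xr lr x (velocity t₀ x) l := by
  refine ⟨hconv, hG, hkkt, hM, fun t ht => hasDerivAt_velocity h.differentiableOn_primal ht,
    fun t ht => ?_, fun t ht => ?_⟩
  · refine (hasDerivAt_velocity h.differentiableOn_velocity ht).congr_deriv ?_
    have h1 := h.primal_eq t ht.le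
    have h2 : HasGradientAt (fun u => lagrangian f A b u (l t)) (G (x t) + A.adjoint (l t))
        (x t) := by
      have := hasGradientAt_primal (hG (x t)) A b 0 (l t)
      simpa [lagrangian] using this
    rw [h2.gradient] at h1
    rw [eq_sub_iff_add_eq, eq_neg_iff_add_eq_zero, ← h1]
    abel
  · refine (hasDerivAt_velocity h.differentiableOn_dual ht).congr_deriv ?_
    have h1 := h.dual_eq t ht.le
    have h2 : HasGradientAt (fun m => lagrangian f A b (x t + (θ * t ^ q) • velocity t₀ x t) m)
        (A (x t + (θ * t ^ q) • velocity t₀ x t) - b) (l t) := by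
      have := hasGradientAt_dual (f (x t + (θ * t ^ q) • velocity t₀ x t))
        (A (x t + (θ * t ^ q) • velocity t₀ x t) - b) 0 0 (l t)
      simpa [lagrangian] using this
    rw [h2.gradient] at h1
    exact sub_eq_zero.1 h1

namespace IsRegularizedFlow

variable {f : X → ℝ} {G : X → X} {A : X →L[ℝ] Y} {b : Y} {α θ q p s c t₀ M : ℝ}
  {xr : ℝ → X} {lr : ℝ → Y} {x v : ℝ → X} {l : ℝ → Y}

/-- The regularized point x_t violates the constraint by exactly (c/t^p) l_t, which is the origin of
the term 1/t^p in the rates. -/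
theorem norm_residual_le (h : IsRegularizedFlow f G A b α θ q p s c t₀ M xr lr x v l)
    (hc : 0 < c) (ht₀ : 0 < t₀) {t : ℝ} (ht : t₀ ≤ t) (y : X) :
    ‖A y - b‖ ≤ ‖A‖ * ‖y - xr t‖ + c / t ^ p * M := by
  have h1 : A y - b = A (y - xr t) + (c / t ^ p) • lr t := by
    rw [← show A (xr t) - b = (c / t ^ p) • lr t from (h.kkt t ht).2, map_sub]
    abel
  have : 0 < t ^ p := Real.rpow_pos_of_pos (ht₀.trans_le ht) _
  have h2 : 0 ≤ c / t ^ p := by positivity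
  rw [h1]
  refine (norm_add_le _ _).trans (add_le_add (A.le_opNorm _) ?_)
  rw [norm_smul, Real.norm_of_nonneg h2]
  exact mul_le_mul_of_nonneg_left (h.norm_lr_le ht) h2

/-- Replacing the multiplier ls by l_t costs at most 2M times the residual. Minimality of x_t
against xs then compares the two gaps up to O(c/t^p). -/
theorem lagrangian_gap_le (h : IsRegularizedFlow f G A b α θ q p s c t₀ M xr lr x v l)
    (hc : 0 < c) (ht₀ : 0 < t₀) {t : ℝ} (ht : t₀ ≤ t) {xs : X} {ls : Y}
    (hs : IsKKT G A b 0 (xs, ls)) (hxs : ‖xs‖ ≤ M) (hls : ‖ls‖ ≤ M) (y : X) :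
    lagrangian f A b y ls - lagrangian f A b xs ls
      ≤ regL f A b (c / t ^ p) y (lr t) - regL f A b (c / t ^ p) (xr t) (lr t)
        + c / t ^ p * (M ^ 2 / 2) + 2 * M * ‖A y - b‖ := by
  have : 0 < t ^ p := Real.rpow_pos_of_pos (ht₀.trans_le ht) _
  have he : 0 ≤ c / t ^ p := by positivity
  set e := c / t ^ p
  have h1 := (h.kkt t ht).regL_le h.convex h.grad xs
  have h2 : 0 ≤ e / 2 * ‖xs - xr t‖ ^ 2 := by positivity
  have h3 : A xs - b = 0 := by simpa using hs.2
  have h4 : ⟪ls - lr t, A y - b⟫_ℝ ≤ 2 * M * ‖A y - b‖ := by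
    refine (real_inner_le_norm _ _).trans (mul_le_mul_of_nonneg_right ?_ (norm_nonneg _))
    have := h.norm_lr_le ht
    linarith [norm_sub_le ls (lr t)]
  rw [inner_sub_left] at h4
  have h5 : e * ‖xs‖ ^ 2 ≤ e * M ^ 2 := by gcongr
  have h6 : 0 ≤ e * ‖y‖ ^ 2 := by positivity
  simp only [regL, lagrangian, h3, inner_zero_right] at *
  linarith

theorem lagrangian_gap_nonneg (h : IsRegularizedFlow f G A b α θ q p s c t₀ M xr lr x v l)
    {xs : X} {ls : Y} (hs : IsKKT G A b 0 (xs, ls)) (y : X) :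
    0 ≤ lagrangian f A b y ls - lagrangian f A b xs ls := by
  have := hs.regL_le h.convex h.grad y
  rw [lagrangian_eq_regL, lagrangian_eq_regL]
  linarith

theorem abs_sub_le {f : X → ℝ} {xs : X} {ls : Y} (hs : IsKKT G A b 0 (xs, ls)) (hls : ‖ls‖ ≤ M)
    (y : X) :
    |f y - f xs| ≤ |lagrangian f A b y ls - lagrangian f A b xs ls| + M * ‖A y - b‖ := by
  have h3 : A xs - b = 0 := by simpa using hs.2
  have h4 : |⟪ls, A y - b⟫_ℝ| ≤ M * ‖A y - b‖ :=
    (abs_real_inner_le_norm _ _).trans (mul_le_mul_of_nonneg_right hls (norm_nonneg _))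
  have h5 : f y - f xs = lagrangian f A b y ls - lagrangian f A b xs ls - ⟪ls, A y - b⟫_ℝ := by
    rw [lagrangian, lagrangian, h3, inner_zero_right]; ring
  rw [h5]
  exact (_root_.abs_sub _ _).trans (by linarith)

/-- Both regimes at once, in terms of `r` and `m`. The unregularized gap inherits the slower of the
rate of the regularized gap and that of the residual, whence the two upper bounds on `β`. -/
theorem asymptotics (h : IsRegularizedFlow f G A b α θ q p s c t₀ M xr lr x v l)
    (hαθ : 1 < α * θ) (hθ : 0 < θ) (hc : 0 < c) (hp : 0 < p) (ht₀ : 0 < t₀) (hq0 : 0 ≤ q)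
    (hq1 : q < 1) (hpq : p ≤ 1 - q) (hs : p - q - 1 < s) {r m : ℝ} (hr : r < 1)
    (hrq : q ≤ r) (hrp : p - q - s ≤ r) (hm1 : 2 * q + s - 1 ≤ m) (hm2 : r - 2 ≤ m)
    (hmr : m + r < 0) {xs : X} {ls : Y} (hsol : IsKKT G A b 0 (xs, ls)) (hxs : ‖xs‖ ≤ M)
    (hls : ‖ls‖ ≤ M) :
    Tendsto (fun t => pairNorm ((x t, l t) - (xr t, lr t))) atTop (𝓝 0) ∧
    ((fun t => regLagrangian f A b c p t (x t) (lr t)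
        - regLagrangian f A b c p t (xr t) (lr t)) =O[atTop]
      fun t : ℝ => 1 / t ^ (2 * q + s - (m + r))) ∧
    ((fun t => ‖x t - xr t‖ ^ 2) =O[atTop] fun t : ℝ => 1 / t ^ (-(m + r))) ∧
    ((fun t => ‖l t - lr t‖ ^ 2) =O[atTop] fun t : ℝ => 1 / t ^ (-(m + r))) ∧
    ((fun t => ‖v t‖ ^ 2) =O[atTop] fun t : ℝ => 1 / t ^ (2 * q - (m + r))) ∧
    ((fun t => ‖A (x t) - b‖) =O[atTop] fun t : ℝ => 1 / t ^ p + 1 / t ^ (-(m + r) / 2)) ∧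
    ∀ β, β ≤ 2 * q + s - (m + r) → β ≤ -(m + r) / 2 →
      ((fun t => lagrangian f A b (x t) ls - lagrangian f A b xs ls) =O[atTop]
        fun t : ℝ => 1 / t ^ p + 1 / t ^ β) ∧
      ((fun t => |f (x t) - f xs|) =O[atTop] fun t : ℝ => 1 / t ^ p + 1 / t ^ β) := by
  obtain ⟨K, hK0, hK⟩ := h.exists_decay_bounds hαθ hθ hc hp ht₀ hq0 hq1 hpq hs hr hrq hrp hm1 hm2
  have hM : 0 ≤ M := (norm_nonneg _).trans hxs
  have hsqrt : ∀ {y t : ℝ}, 0 < t → y ^ 2 ≤ K * t ^ (m + r) →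
      y ≤ √K * t ^ (-(-(m + r) / 2)) := fun {y t} h0 hy => by
    refine le_of_sq_le_sq ?_ (mul_nonneg (Real.sqrt_nonneg _) (Real.rpow_pos_of_pos h0 _).le)
    rw [mul_pow, Real.sq_sqrt hK0, ← Real.rpow_natCast (t ^ _), ← Real.rpow_mul h0.le,
      show -(-(m + r) / 2) * ((2 : ℕ) : ℝ) = m + r by push_cast; ring]
    exact hy
  set C := ‖A‖ * √K + c * M with hC
  have hC0 : 0 ≤ C := by positivity
  have hA : ∀ᶠ t in atTop, ‖A (x t) - b‖ ≤ C * (t ^ (-p) + t ^ (-(-(m + r) / 2))) := by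
    filter_upwards [hK, eventually_ge_atTop t₀] with t ht htt
    have h0 : 0 < t := ht₀.trans_le htt
    have h1 := h.norm_residual_le hc ht₀ htt (x t)
    have h2 := mul_le_mul_of_nonneg_left (hsqrt h0 ht.2.1) (norm_nonneg A)
    have h3 : c / t ^ p * M = c * M * t ^ (-p) := by rw [Real.rpow_neg h0.le]; ring
    have h4 : 0 < t ^ (-p) := Real.rpow_pos_of_pos h0 _
    have h5 : 0 < t ^ (-(-(m + r) / 2)) := Real.rpow_pos_of_pos h0 _
    have h6 : 0 ≤ ‖A‖ * √K * t ^ (-p) := by positivity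
    have h7 : 0 ≤ c * M * t ^ (-(-(m + r) / 2)) := by positivity
    rw [hC]
    linarith
  have hgap : ∀ β, β ≤ 2 * q + s - (m + r) → β ≤ -(m + r) / 2 → ∀ᶠ t in atTop,
      lagrangian f A b (x t) ls - lagrangian f A b xs ls
        ≤ (K + c * (M ^ 2 / 2) + 2 * M * C) * (t ^ (-p) + t ^ (-β)) ∧
      ‖A (x t) - b‖ ≤ C * (t ^ (-p) + t ^ (-β)) := fun β hβ1 hβ2 => by
    filter_upwards [hK, hA, eventually_ge_atTop t₀, eventually_ge_atTop 1] with t ht hAt htt ht1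
    have h0 : 0 < t := ht₀.trans_le htt
    have h1 := h.lagrangian_gap_le hc ht₀ htt hsol hxs hls (x t)
    have h4 : 0 < t ^ (-p) := Real.rpow_pos_of_pos h0 _
    have h5 : 0 < t ^ (-β) := Real.rpow_pos_of_pos h0 _
    have h6 : t ^ (m + r - 2 * q - s) ≤ t ^ (-β) :=
      Real.rpow_le_rpow_of_exponent_le ht1 (by linarith)
    have h7 : t ^ (-(-(m + r) / 2)) ≤ t ^ (-β) :=
      Real.rpow_le_rpow_of_exponent_le ht1 (by linarith)
    have h8 : ‖A (x t) - b‖ ≤ C * (t ^ (-p) + t ^ (-β)) :=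
      hAt.trans (mul_le_mul_of_nonneg_left (by linarith) hC0)
    refine ⟨h1.trans ?_, h8⟩
    have h9 : c / t ^ p * (M ^ 2 / 2) = c * (M ^ 2 / 2) * t ^ (-p) := by
      rw [Real.rpow_neg h0.le]; ring
    have h10 := mul_le_mul_of_nonneg_left h8 (show 0 ≤ 2 * M by positivity)
    have h11 := mul_le_mul_of_nonneg_left h6 hK0
    have h12 : 0 ≤ K * t ^ (-p) := by positivity
    have h13 : 0 ≤ c * (M ^ 2 / 2) * t ^ (-β) := by positivity
    linarith [ht.1]
  refine ⟨?_, ?_, ?_, ?_, ?_, ?_, fun β hβ1 hβ2 => ⟨?_, ?_⟩⟩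
  · have hlim : Tendsto (fun t : ℝ => √K * t ^ (-(-(m + r) / 2)) + √K * t ^ (-(-(m + r) / 2)))
        atTop (𝓝 0) := by
      have h1 := (tendsto_rpow_neg_atTop (show 0 < -(m + r) / 2 by linarith)).const_mul √K
      simpa using h1.add h1
    refine squeeze_zero' (Eventually.of_forall fun t => norm_nonneg _) ?_ hlim
    filter_upwards [hK, eventually_gt_atTop 0] with t ht h0
    refine (pairNorm_le _).trans ?_
    exact add_le_add (hsqrt h0 ht.2.1) (hsqrt h0 ht.2.2.1)
  · refine isBigO_one_div_rpow (K := K) ?_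
    filter_upwards [hK, eventually_ge_atTop t₀] with t ht htt
    rw [regLagrangian_eq_regL, regLagrangian_eq_regL]
    refine ⟨h.regL_gap_nonneg hc ht₀ htt (x t), ht.1.trans_eq ?_⟩
    congr 2; ring
  · refine isBigO_one_div_rpow (K := K) ?_
    filter_upwards [hK] with t ht
    rw [neg_neg]
    exact ⟨sq_nonneg _, ht.2.1⟩
  · refine isBigO_one_div_rpow (K := K) ?_
    filter_upwards [hK] with t ht
    rw [neg_neg]
    exact ⟨sq_nonneg _, ht.2.2.1⟩
  · refine isBigO_one_div_rpow (K := K) ?_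
    filter_upwards [hK] with t ht
    rw [neg_sub]
    exact ⟨sq_nonneg _, ht.2.2.2⟩
  · refine isBigO_one_div_rpow_add (K := C) ?_
    filter_upwards [hA] with t ht using ⟨norm_nonneg _, ht⟩
  · refine isBigO_one_div_rpow_add (K := K + c * (M ^ 2 / 2) + 2 * M * C) ?_
    filter_upwards [hgap β hβ1 hβ2] with t ht using ⟨h.lagrangian_gap_nonneg hsol _, ht.1⟩
  · refine isBigO_one_div_rpow_add (K := K + c * (M ^ 2 / 2) + 2 * M * C + M * C) ?_
    filter_upwards [hgap β hβ1 hβ2] with t ht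
    refine ⟨abs_nonneg _, (abs_sub_le hsol hls (x t)).trans ?_⟩
    rw [abs_of_nonneg (h.lagrangian_gap_nonneg hsol _)]
    have := mul_le_mul_of_nonneg_left ht.2 hM
    linarith [ht.1]

end IsRegularizedFlow

end TikhonovPD

end

/-! ### The theorem: choice of exponents in the two regimes -/

theorem theorem3p1 {X Y : Type*}
    [NormedAddCommGroup X] [InnerProductSpace ℝ X] [CompleteSpace X]
    [NormedAddCommGroup Y] [InnerProductSpace ℝ Y] [CompleteSpace Y]
    (f : X → ℝ) (A : X →L[ℝ] Y) (b : Y)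
    (hf : ContDiff ℝ 1 f) (hconv : ConvexOn ℝ Set.univ f)
    (hΩ : (TikhonovPD.saddleSet (TikhonovPD.lagrangian f A b)).Nonempty)
    (α θ q p s c t₀ : ℝ)
    (hα : 0 < α) (hθ : 1 / α < θ) (hq₀ : 0 ≤ q) (hq₁ : q < 1)
    (hp₀ : 0 < p) (hp₁ : p < 1 - q) (hc : 0 < c) (ht₀ : 0 < t₀)
    (hs₀ : p - q - 1 < s) (hs₁ : s < 1 - 3 * q) :
    -- the minimum norm solution and the regularized saddle points are well defined
    (∃! z : X × Y,
      TikhonovPD.IsMinNormElement (TikhonovPD.saddleSet (TikhonovPD.lagrangian f A b)) z) ∧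
    (∀ t, t₀ ≤ t →
      ∃! z : X × Y, z ∈ TikhonovPD.saddleSet (TikhonovPD.regLagrangian f A b c p t)) ∧
    ∀ (xs : X) (ls : Y),
      TikhonovPD.IsMinNormElement
        (TikhonovPD.saddleSet (TikhonovPD.lagrangian f A b)) (xs, ls) →
    ∀ (xr : ℝ → X) (lr : ℝ → Y),
      (∀ t, t₀ ≤ t →
        (xr t, lr t) ∈ TikhonovPD.saddleSet (TikhonovPD.regLagrangian f A b c p t)) →
    ∀ (x : ℝ → X) (l : ℝ → Y),
      TikhonovPD.IsTrajectory f A b α θ q p s c t₀ x l →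
      -- strong convergence
      Tendsto (fun t => TikhonovPD.pairNorm ((x t, l t) - (xs, ls))) atTop (𝓝 0) ∧
      -- first regime
      (s < (p - 3 * q - 1) / 2 →
        ((fun t => ‖x t - xr t‖ ^ 2) =O[atTop]
          fun t : ℝ => 1 / t ^ (2 * (1 + s + q - p))) ∧
        ((fun t => ‖l t - lr t‖ ^ 2) =O[atTop]
          fun t : ℝ => 1 / t ^ (2 * (1 + s + q - p))) ∧
        ((fun t => ‖TikhonovPD.velocity t₀ x t‖ ^ 2) =O[atTop]
          fun t : ℝ => 1 / t ^ (2 * (1 + s + 2 * q - p))) ∧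
        ((fun t => ‖A (x t) - b‖) =O[atTop]
          fun t : ℝ => 1 / t ^ p + 1 / t ^ (1 + s + q - p)) ∧
        ((2 * p - 2 - 4 * q) / 3 < s →
          ((fun t => TikhonovPD.regLagrangian f A b c p t (x t) (lr t)
              - TikhonovPD.regLagrangian f A b c p t (xr t) (lr t)) =O[atTop]
            fun t : ℝ => 1 / t ^ (4 * q + 3 * s - 2 * p + 2)) ∧
          ((fun t => TikhonovPD.lagrangian f A b (x t) ls
              - TikhonovPD.lagrangian f A b xs ls) =O[atTop]
            fun t : ℝ => 1 / t ^ p + 1 / t ^ (4 * q + 3 * s - 2 * p + 2)) ∧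
          ((fun t => |f (x t) - f xs|) =O[atTop]
            fun t : ℝ => 1 / t ^ p + 1 / t ^ (4 * q + 3 * s - 2 * p + 2)))) ∧
      -- second regime
      ((p - 3 * q - 1) / 2 ≤ s → ∀ r : ℝ, r = max q (p - q - s) →
        ((fun t => TikhonovPD.regLagrangian f A b c p t (x t) (lr t)
            - TikhonovPD.regLagrangian f A b c p t (xr t) (lr t)) =O[atTop]
          fun t : ℝ => 1 / t ^ (1 - r)) ∧
        ((fun t => ‖x t - xr t‖ ^ 2) =O[atTop]
          fun t : ℝ => 1 / t ^ (1 - 2 * q - s - r)) ∧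
        ((fun t => ‖l t - lr t‖ ^ 2) =O[atTop]
          fun t : ℝ => 1 / t ^ (1 - 2 * q - s - r)) ∧
        ((fun t => ‖TikhonovPD.velocity t₀ x t‖ ^ 2) =O[atTop]
          fun t : ℝ => 1 / t ^ (1 - s - r)) ∧
        ((fun t => TikhonovPD.lagrangian f A b (x t) ls
            - TikhonovPD.lagrangian f A b xs ls) =O[atTop]
          fun t : ℝ => 1 / t ^ p + 1 / t ^ ((1 - 2 * q - s - r) / 2)) ∧
        ((fun t => |f (x t) - f xs|) =O[atTop]
          fun t : ℝ => 1 / t ^ p + 1 / t ^ ((1 - 2 * q - s - r) / 2)) ∧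
        ((fun t => ‖A (x t) - b‖) =O[atTop]
          fun t : ℝ => 1 / t ^ p + 1 / t ^ ((1 - 2 * q - s - r) / 2))) := by
  have hdiff : Differentiable ℝ f := hf.differentiable one_ne_zero
  have hG : ∀ x, HasGradientAt f (gradient f x) x := fun x => (hdiff x).hasGradientAt
  have hGc : Continuous (gradient f) :=
    (InnerProductSpace.toDual ℝ X).symm.continuous.comp (hf.continuous_fderiv one_ne_zero)
  have hmono := TikhonovPD.monotone_gradient hconv hG
  have hepos : ∀ t, t₀ ≤ t → 0 < c / t ^ p := fun t ht =>
    div_pos hc (Real.rpow_pos_of_pos (ht₀.trans_le ht) _)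
  have hanti : ∀ t τ, t₀ ≤ t → t < τ → c / τ ^ p < c / t ^ p := fun t τ ht hτ => by
    have h0 : 0 < t := ht₀.trans_le ht
    have h1 : 0 < t ^ p := Real.rpow_pos_of_pos h0 _
    gcongr
  have hΩiff := TikhonovPD.mem_saddleSet_lagrangian_iff hconv hG A b
  have hregiff : ∀ t, t₀ ≤ t → ∀ z, z ∈ TikhonovPD.saddleSet
      (TikhonovPD.regLagrangian f A b c p t) ↔ TikhonovPD.IsKKT (gradient f) A b (c / t ^ p) z :=
    fun t ht => TikhonovPD.mem_saddleSet_regLagrangian_iff hconv hG A b (hepos t ht).le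
  have hne : ∃ z, TikhonovPD.IsKKT (gradient f) A b 0 z := hΩ.imp fun z hz => (hΩiff z).1 hz
  refine ⟨?_, fun t ht => ?_, ?_⟩
  · have hex : ∀ t, ∃ z, t₀ ≤ t → TikhonovPD.IsKKT (gradient f) A b (c / t ^ p) z := fun t => by
      by_cases ht : t₀ ≤ t
      · exact (TikhonovPD.exists_isKKT hconv hG A b (hepos t ht)).imp fun z hz _ => hz
      · exact ⟨0, fun h => absurd h ht⟩
    choose z hz using hex
    obtain ⟨w, hw1, -, hw2⟩ := TikhonovPD.exists_tendsto_isKKT hmono hGc hne hepos hanti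
      (TikhonovPD.tendsto_div_rpow_atTop hp₀) hz
    have hw2' : ∀ v ∈ TikhonovPD.saddleSet (TikhonovPD.lagrangian f A b),
        TikhonovPD.pairNorm w ^ 2 + TikhonovPD.pairNorm (v - w) ^ 2 ≤ TikhonovPD.pairNorm v ^ 2 :=
      fun v hv => hw2 v ((hΩiff v).1 hv)
    exact ⟨w, TikhonovPD.isMinNormElement_of_sq ((hΩiff w).2 hw1) hw2',
      fun v hv => TikhonovPD.eq_of_isMinNormElement ((hΩiff w).2 hw1) hw2' hv⟩
  · obtain ⟨z, hz⟩ := TikhonovPD.exists_isKKT hconv hG A b (hepos t ht)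
    exact ⟨z, (hregiff t ht z).2 hz,
      fun w hw => ((hregiff t ht w).1 hw).unique hmono (hepos t ht) hz⟩
  · intro xs ls hmin xr lr hr x l htraj
    have hkkt : ∀ t, t₀ ≤ t → TikhonovPD.IsKKT (gradient f) A b (c / t ^ p) (xr t, lr t) :=
      fun t ht => (hregiff t ht _).1 (hr t ht)
    have hsol : TikhonovPD.IsKKT (gradient f) A b 0 (xs, ls) := (hΩiff _).1 hmin.1
    obtain ⟨w, hw1, hlim, hw2⟩ := TikhonovPD.exists_tendsto_isKKT hmono hGc hne hepos hanti
      (TikhonovPD.tendsto_div_rpow_atTop hp₀) hkkt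
    obtain rfl : (xs, ls) = w := TikhonovPD.eq_of_isMinNormElement ((hΩiff w).2 hw1)
      (fun v hv => hw2 v ((hΩiff v).1 hv)) hmin
    -- Every regularized saddle point has norm at most that of the minimum norm solution, which
    -- serves as `M`.
    have hflow := htraj.isRegularizedFlow (M := TikhonovPD.pairNorm (xs, ls)) hconv hG hkkt
      fun t ht => (hkkt t ht).pairNorm_le hmono (hepos t ht) hsol
    have hxs := TikhonovPD.norm_fst_le_pairNorm (xs, ls)
    have hls := TikhonovPD.norm_snd_le_pairNorm (xs, ls)
    have hαθ : 1 < α * θ := by rwa [div_lt_iff₀' hα] at hθ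
    have hθ0 : 0 < θ := (one_div_pos.2 hα).trans hθ
    have hconvg : Tendsto (fun t => TikhonovPD.pairNorm ((x t, l t) - (xr t, lr t))) atTop (𝓝 0) →
        Tendsto (fun t => TikhonovPD.pairNorm ((x t, l t) - (xs, ls))) atTop (𝓝 0) := fun h => by
      refine squeeze_zero (fun t => norm_nonneg _) (fun t => ?_) (by simpa using h.add hlim)
      have := norm_add_le (WithLp.toLp 2 ((x t, l t) - (xr t, lr t)))
        (WithLp.toLp 2 ((xr t, lr t) - (xs, ls)))
      rwa [← WithLp.toLp_add, sub_add_sub_cancel] at this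
    rcases lt_or_ge s ((p - 3 * q - 1) / 2) with hcase | hcase
    -- First regime: p-q-s exceeds q, and s < (p-3q-1)/2 means that r - 2 is the larger source
    -- exponent. Negativity of m + r = 2(p-q-s-1) is the lower bound on s.
    · obtain ⟨h1, h2, h3, h4, h5, h6, h7⟩ := hflow.asymptotics hαθ hθ0 hc hp₀ ht₀ hq₀ hq₁ hp₁.le hs₀
        (r := p - q - s) (m := p - q - s - 2) (by linarith) (by linarith) le_rfl (by linarith)
        le_rfl (by linarith) hsol hxs hls
      have e1 : -(p - q - s - 2 + (p - q - s)) = 2 * (1 + s + q - p) := by ring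
      have e2 : 2 * q + s - (p - q - s - 2 + (p - q - s)) = 4 * q + 3 * s - 2 * p + 2 := by ring
      have e3 : 2 * q - (p - q - s - 2 + (p - q - s)) = 2 * (1 + s + 2 * q - p) := by ring
      have e4 : 2 * (1 + s + q - p) / 2 = 1 + s + q - p := by ring
      rw [e1] at h3 h4
      rw [e1, e4] at h6
      rw [e2] at h2
      rw [e3] at h5
      obtain ⟨h8, h9⟩ := h7 (4 * q + 3 * s - 2 * p + 2) (by linarith) (by linarith)
      exact ⟨hconvg h1, fun _ => ⟨h3, h4, h5, h6, fun _ => ⟨h2, h8, h9⟩⟩,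
        fun hcase' => absurd hcase (not_lt.2 hcase')⟩
    · have hr1 : max q (p - q - s) < 1 := max_lt hq₁ (by linarith)
      -- This is r - 2 ≤ 2q+s-1: in the second regime the source from the weighted gap dominates.
      have hr2 : max q (p - q - s) ≤ 2 * q + s + 1 := max_le (by linarith) (by linarith)
      -- This is m + r < 0; its two halves are s < 1 - 3q and p < 1 - q.
      have hr3 : max q (p - q - s) < 1 - 2 * q - s := max_lt (by linarith) (by linarith)
      have hr4 := le_max_left q (p - q - s)
      have hr5 := le_max_right q (p - q - s)
      set r := max q (p - q - s) with hrdef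
      obtain ⟨h1, h2, h3, h4, h5, h6, h7⟩ := hflow.asymptotics hαθ hθ0 hc hp₀ ht₀ hq₀ hq₁ hp₁.le hs₀
        (r := r) (m := 2 * q + s - 1) hr1 hr4 hr5 le_rfl (by linarith) (by linarith) hsol hxs hls
      have e1 : -(2 * q + s - 1 + r) = 1 - 2 * q - s - r := by ring
      have e2 : 2 * q + s - (2 * q + s - 1 + r) = 1 - r := by ring
      have e3 : 2 * q - (2 * q + s - 1 + r) = 1 - s - r := by ring
      rw [e1] at h3 h4 h6
      rw [e2] at h2
      rw [e3] at h5
      obtain ⟨h8, h9⟩ := h7 ((1 - 2 * q - s - r) / 2) (by linarith) (by linarith)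
      refine ⟨hconvg h1, fun hcase' => absurd hcase' (not_lt.2 hcase), ?_⟩
      intro _ r' hr'
      rw [hr']
      exact ⟨h2, h3, h4, h5, h8, h9, h6⟩
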